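/- Let $I$ be a finite or countably infinite index set, let $X_i$ ($i\in I$) be $\sigma$-finite measure spaces and put $H_i:=L^2(X_i)$ (complex-valued functions), $H:=\bigoplus_{i\in I}H_i$ (Hilbert direct sum). Let $V_i$ be complex Hilbert spaces that are densely and continuously embedded in $H_i$, with $\|\psi\|_{H_i}\le M\|\psi\|_{V_i}$ for a constant $M$ independent of $i$, and let $V:=\bigoplus_{i\in I}V_i$ be their Hilbert direct sum, so that $V\hookrightarrow H$. Let $a:V\times V\to\mathbb C$ be a sesquilinear form (linear in the first, antilinear in the second variable) which is continuous ($|a(\psi,\psi')|\le C\|\psi\|_V\|\psi'\|_V$), $H$-elliptic ($\operatorname{Re}a(\psi,\psi)+\omega\|\psi\|_H^2\ge\alpha\|\psi\|_V^2$ for some $\alpha>0$, $\omega\in\mathbb R$) and accretive ($\operatorname{Re}a(\psi,\psi)\ge0$). For $i,j\in I$ let $a_{ij}:V_j\times V_i\to\mathbb C$ be its entries: $a_{ij}(\psi,\psi')$ is the value of $a$ at the vector with $\psi$ at place $j$ and $0$ elsewhere and the vector with $\psi'$ at place $i$ and $0$ elsewhere. Let $A$ be the operator on $H$ associated with $a$: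 $D(A)=\{\psi\in V:\exists f\in H\ \forall\psi'\in V:\ a(\psi,\psi')=(f\mid\psi')_H\}$, $A\psi=-f$. Then there is exactly one strongly continuous semigroup $(e^{ta})_{t\ge0}$ on $H$ with generator $A$, likewise exactly one strongly continuous semigroup $(e^{ta_{ii}})_{t\ge0}$ on $H_i$ whose generator is the operator associated with $a_{ii}$, for each $i\in I$, and the following assertions hold. Here an element of $H$ is real, or positive, if each of its components is almost everywhere real, or almost everywhere real and $\ge0$; a semigroup is real, or positive, if it maps real elements to real elements, or positive elements to positive elements; $\|f\|_\infty:=\sup_{i\in I}\|f_i\|_{L^\infty(X_i)}$ for $f\in H$, and $(e^{ta})_{t\ge0}$ is $L^\infty$-contractive if $\|e^{ta}f\|_\infty\le\|f\|_\infty$ for all $t\ge0$ and all $f\in H$ with $\|f\|_\infty<\infty$; $V_i^+$ is the set of positive elements of $V_i$; and $\operatorname{sign}z:=z/|z|$ for $z\in\mathbb C\setminus\{0\}$, $\operatorname{sign}0:=0$. (a) The semigroup $(e^{ta})_{t\ge0}$ is real if and only if the following two conditions hold: - for all $i\in I$, $\psi\in V_i$ implies $\operatorname{Re}\psi\in V_i$;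 - for all $i,j\in I$ the mapping $a_{ij}$ is real, i.e. $\operatorname{Im}a_{ij}(\psi,\psi')=0$ for all real $\psi\in V_j$, $\psi'\in V_i$. (b) If $(e^{ta})_{t\ge0}$ is real, then it is positive if and only if the following two conditions hold: - for all $i\in I$ the semigroup $(e^{ta_{ii}})_{t\ge0}$ on $H_i$ is positive; - for all $i\neq j$, $a_{ij}(\psi,\psi')$ is real and $\le0$ for all $\psi\in V_j^+$, $\psi'\in V_i^+$. (c) If $(e^{ta})_{t\ge0}$ is contractive ($\|e^{ta}\|\le1$ for all $t\ge0$), then it is $L^\infty$-contractive if and only if the following two conditions hold: - for all $i\in I$, $\psi\in V_i$ implies $(1\wedge|\psi|)\operatorname{sign}\psi\in V_i$; - for all $i\in I$ and all $\psi=(\psi_j)_{j\in I}\in V$ with $\|\psi_j\|_{L^\infty(X_j)}\le1$ for every $j\ne i$, $$\sum_{j\neq i}\bigl|a_{ij}\bigl(\psi_j,(|\psi_i|-1)^+\operatorname{sign}\psi_i\bigr)\bigr|\le\operatorname{Re}a_{ii}\bigl((1\wedge|\psi_i|)\operatorname{sign}\psi_i,(|\psi_i|-1)^+\operatorname{sign}\psi_i\bigr).$$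 -/

import Mathlib

open MeasureTheory Filter Topology
open scoped ENNReal NNReal InnerProductSpace

noncomputable section

/-! ### Forms on a Hilbert space and their semigroups -/

section Forms

variable {H : Type*} [NormedAddCommGroup H] [InnerProductSpace ℂ H]
variable {V : Type*} [NormedAddCommGroup V] [InnerProductSpace ℂ V]

/-- A sesquilinear form `a : V × V → ℂ` (linear in the first, antilinear in the second variable)
is continuous if `|a(ψ,ψ')| ≤ M ‖ψ‖ ‖ψ'‖` for some constant `M`. -/
def FormContinuous (a : V →ₗ[ℂ] V →ₗ⋆[ℂ] ℂ) : Prop :=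
  ∃ M : ℝ, ∀ ψ ψ' : V, ‖a ψ ψ'‖ ≤ M * ‖ψ‖ * ‖ψ'‖

/-- Accretivity: `Re a(ψ,ψ) ≥ 0`. -/
def FormAccretive (a : V →ₗ[ℂ] V →ₗ⋆[ℂ] ℂ) : Prop :=
  ∀ ψ : V, 0 ≤ (a ψ ψ).re

/-- `H`-ellipticity with respect to the embedding `J` of the form domain `V` in `H`:
`Re a(ψ,ψ) + ω ‖ψ‖_H² ≥ α ‖ψ‖_V²` for some `α > 0` and `ω ∈ ℝ`. -/
def FormElliptic (J : V →L[ℂ] H) (a : V →ₗ[ℂ] V →ₗ⋆[ℂ] ℂ) : Prop :=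
  ∃ α : ℝ, 0 < α ∧ ∃ ω : ℝ, ∀ ψ : V, α * ‖ψ‖ ^ 2 ≤ (a ψ ψ).re + ω * ‖J ψ‖ ^ 2

/-- The graph `{(x, A x)}` of the operator `A` associated with the form `a`, whose domain `V` is
embedded in `H` by `J`: `x ∈ D(A)` and `A x = -f` mean that `x = J ψ` with `ψ ∈ V` and
`a(ψ,ψ') = (f | ψ')_H` for all `ψ' ∈ V`. Mathlib's inner product is antilinear in its first
argument, so `(f | ψ')_H` is `⟪J ψ', f⟫_ℂ`. -/
def formOperatorGraph (J : V →L[ℂ] H) (a : V →ₗ[ℂ] V →ₗ⋆[ℂ] ℂ) : Set (H × H) :=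
  {p | ∃ ψ : V, J ψ = p.1 ∧ ∃ f : H, (∀ ψ' : V, a ψ ψ' = ⟪J ψ', f⟫_ℂ) ∧ p.2 = -f}

/-- A strongly continuous one-parameter semigroup of bounded operators on `H`. -/
structure IsC0Semigroup (T : ℝ≥0 → (H →L[ℂ] H)) : Prop where
  map_zero : T 0 = 1
  map_add : ∀ s t : ℝ≥0, T (s + t) = T s * T t
  continuous_orbit : ∀ x : H, Continuous fun t : ℝ≥0 => T t x

/-- The graph of the generator of `T`: the pairs `(x, y)` with
`y = lim_{h → 0+} (T(h) x - x) / h`. -/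
def generatorGraph (T : ℝ≥0 → (H →L[ℂ] H)) : Set (H × H) :=
  {p | Tendsto (fun h : ℝ≥0 => (h : ℝ)⁻¹ • (T h p.1 - p.1)) (𝓝[>] 0) (𝓝 p.2)}

/-- `T` is the semigroup `(e^{ta})_{t ≥ 0}` of the form `a`: the strongly continuous semigroup
whose generator is the operator associated with `a`. -/
def IsFormSemigroup (J : V →L[ℂ] H) (a : V →ₗ[ℂ] V →ₗ⋆[ℂ] ℂ) (T : ℝ≥0 → (H →L[ℂ] H)) : Prop :=
  IsC0Semigroup T ∧ generatorGraph T = formOperatorGraph J a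

/-- All operators of the family map the set `C` into itself. -/
def LeavesInvariant (T : ℝ≥0 → (H →L[ℂ] H)) (C : Set H) : Prop :=
  ∀ t : ℝ≥0, ∀ f ∈ C, T t f ∈ C

/-- All operators of the family are contractions of `H`. -/
def IsContractiveFamily (T : ℝ≥0 → (H →L[ℂ] H)) : Prop :=
  ∀ t : ℝ≥0, ‖T t‖ ≤ 1

end Forms

/-! ### Direct sums of Hilbert spaces and form matrices -/

section DirectSum

variable {ι : Type*} {V : ι → Type*} {K : ι → Type*}
  [∀ i, NormedAddCommGroup (V i)] [∀ i, InnerProductSpace ℂ (V i)]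
  [∀ i, NormedAddCommGroup (K i)] [∀ i, InnerProductSpace ℂ (K i)]

/-- The embeddings are uniformly bounded: `‖φ_i ψ‖ ≤ M ‖ψ‖` with `M` independent of `i`. -/
def UniformlyBounded (φ : ∀ i, V i →L[ℂ] K i) : Prop :=
  ∃ M : ℝ, ∀ i, ∀ ψ : V i, ‖φ i ψ‖ ≤ M * ‖ψ‖

theorem UniformlyBounded.exists_nonneg {φ : ∀ i, V i →L[ℂ] K i} (hφ : UniformlyBounded φ) :
    ∃ M : ℝ, 0 ≤ M ∧ ∀ i, ∀ ψ : V i, ‖φ i ψ‖ ≤ M * ‖ψ‖ := by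
  obtain ⟨M, hM⟩ := hφ
  exact ⟨max M 0, le_max_right _ _, fun i ψ => (hM i ψ).trans
    (mul_le_mul_of_nonneg_right (le_max_left _ _) (norm_nonneg _))⟩

theorem UniformlyBounded.memlp {φ : ∀ i, V i →L[ℂ] K i} (hφ : UniformlyBounded φ)
    (ψ : lp V 2) : Memℓp (fun i => φ i (ψ i)) 2 := by
  obtain ⟨M, -, hM⟩ := hφ.exists_nonneg
  have h1 : Memℓp (fun i => (M : ℂ) • ψ i) 2 := (lp.memℓp ψ).const_smul (M : ℂ)
  have h2 := (memℓp_gen_iff (p := 2) (by norm_num)).1 h1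
  refine (memℓp_gen_iff (p := 2) (by norm_num)).2 (h2.of_nonneg_of_le
    (fun i => by positivity) (fun i => ?_))
  refine Real.rpow_le_rpow (norm_nonneg _) ((hM i (ψ i)).trans ?_) (by norm_num)
  rw [norm_smul]
  exact mul_le_mul_of_nonneg_right (by simpa using le_abs_self M) (norm_nonneg _)

/-- The canonical injection `⊕ V_i → ⊕ K_i`, `(ψ_i) ↦ (φ_i ψ_i)`, of the Hilbert direct sums
induced by uniformly bounded `φ_i : V_i → K_i`. -/
def directSumMap (φ : ∀ i, V i →L[ℂ] K i) (hφ : UniformlyBounded φ) : lp V 2 →L[ℂ] lp K 2 :=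
  LinearMap.mkContinuousOfExistsBound
    { toFun := fun ψ => ⟨fun i => φ i (ψ i), hφ.memlp ψ⟩
      map_add' := fun ψ ψ' => by ext i; exact map_add (φ i) _ _
      map_smul' := fun c ψ => by ext i; exact map_smul (φ i) _ _ }
    (by
      obtain ⟨M, hM0, hM⟩ := hφ.exists_nonneg
      refine ⟨M, fun ψ => ?_⟩
      refine lp.norm_le_of_forall_sum_le (p := 2) (by norm_num) (by positivity) (fun s => ?_)
      have h := lp.sum_rpow_le_norm_rpow (p := 2) (by norm_num) ψ s
      simp only [ENNReal.toReal_ofNat, Real.rpow_ofNat] at h ⊢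
      calc ∑ i ∈ s, ‖φ i (ψ i)‖ ^ 2 ≤ ∑ i ∈ s, M ^ 2 * ‖ψ i‖ ^ 2 :=
            Finset.sum_le_sum fun i _ => by
              rw [← mul_pow]; exact pow_le_pow_left₀ (norm_nonneg _) (hM i (ψ i)) 2
        _ = M ^ 2 * ∑ i ∈ s, ‖ψ i‖ ^ 2 := by rw [Finset.mul_sum]
        _ ≤ (M * ‖ψ‖) ^ 2 := by
            rw [mul_pow]; exact mul_le_mul_of_nonneg_left h (by positivity))

theorem directSumMap_apply (φ : ∀ i, V i →L[ℂ] K i) (hφ : UniformlyBounded φ) (ψ : lp V 2)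
    (i : ι) : directSumMap φ hφ ψ i = φ i (ψ i) := rfl

/-- The entry `a_{ij} : V_j × V_i → ℂ` of a form on `⊕ V_i`: the value `a_{ij}(ψ,ψ')` is `a` at the
vector with the single component `ψ` at place `j` and the vector with the single component `ψ'`
at place `i`. -/
def formEntry [DecidableEq ι] (a : lp V 2 →ₗ[ℂ] lp V 2 →ₗ⋆[ℂ] ℂ) (i j : ι) :
    V j →ₗ[ℂ] V i →ₗ⋆[ℂ] ℂ :=
  (a.comp (lp.lsingle (𝕜 := ℂ) (E := V) 2 j)).compl₂ (lp.lsingle (𝕜 := ℂ) (E := V) 2 i)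

theorem formEntry_apply [DecidableEq ι] (a : lp V 2 →ₗ[ℂ] lp V 2 →ₗ⋆[ℂ] ℂ) (i j : ι)
    (ψ : V j) (ψ' : V i) :
    formEntry a i j ψ ψ' = a (lp.single 2 j ψ) (lp.single 2 i ψ') := rfl

end DirectSum

/-! ### Real and positive functions, truncation -/

section Functions

/-- The sign of a complex number: `z / |z|` for `z ≠ 0`, and `0` for `z = 0`. -/
def csign (z : ℂ) : ℂ := z / (‖z‖ : ℂ)

/-- `(1 ∧ |z|) sign z`. -/
def unitTrunc (z : ℂ) : ℂ := ((min 1 ‖z‖ : ℝ) : ℂ) * csign z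

/-- `(|z| - 1)^+ sign z`. -/
def unitExcess (z : ℂ) : ℂ := ((max (‖z‖ - 1) 0 : ℝ) : ℂ) * csign z

/-- The almost everywhere real elements of `L²`. -/
def realL2 {X : Type*} [MeasurableSpace X] (μ : Measure X) : Set (Lp ℂ 2 μ) :=
  {f | ∀ᵐ x ∂μ, (f x).im = 0}

/-- The almost everywhere real and nonnegative elements of `L²`. -/
def posL2 {X : Type*} [MeasurableSpace X] (μ : Measure X) : Set (Lp ℂ 2 μ) :=
  {f | ∀ᵐ x ∂μ, (f x).im = 0 ∧ 0 ≤ (f x).re}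

variable {ι : Type*} {X : ι → Type*} [∀ i, MeasurableSpace (X i)] (μ : ∀ i, Measure (X i))

/-- The Hilbert direct sum `H = ⊕ L²(X_i)`. -/
abbrev SumL2 : Type _ := lp (fun i => Lp ℂ 2 (μ i)) 2

/-- The elements of `⊕ L²(X_i)` all of whose components are real almost everywhere. -/
def realSumL2 : Set (SumL2 μ) := {f | ∀ i, f i ∈ realL2 (μ i)}

/-- The elements of `⊕ L²(X_i)` all of whose components are nonnegative almost everywhere. -/
def posSumL2 : Set (SumL2 μ) := {f | ∀ i, f i ∈ posL2 (μ i)}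

/-- The `L^∞` norm (possibly `∞`) of `f ∈ ⊕ L²(X_i)`, regarded as a function on the disjoint union
of the `X_i`. -/
def linftyNorm {μ : ∀ i, Measure (X i)} (f : SumL2 μ) : ℝ≥0∞ := ⨆ i, eLpNorm (f i) ∞ (μ i)

/-- `‖T(t) f‖_∞ ≤ ‖f‖_∞` for all `t ≥ 0` and all `f ∈ H` (equivalently all `f ∈ H ∩ L^∞`). -/
def IsLinftyContractive {μ : ∀ i, Measure (X i)} (T : ℝ≥0 → (SumL2 μ →L[ℂ] SumL2 μ)) : Prop :=
  ∀ t : ℝ≥0, ∀ f : SumL2 μ, linftyNorm (T t f) ≤ linftyNorm f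

end Functions

end

/-!
The theorem reduces to an invariance criterion of Ouhabaz: if `P` is the metric projection of `H`
onto a closed convex set `C`, then the semigroup of an accretive form `a` leaves `C` invariant if
and only if for every `ψ` in the form domain `V` the vector `Pψ` lies in `V` and
`Re a(Pψ, ψ - Pψ) ≥ 0` (`IsFormSemigroup.leavesInvariant_iff`).

Existence and uniqueness of the semigroups. The operator of a form is maximal dissipative, by the
Lax–Milgram theorem (`exists_isMaximalDissipative_formGraph`), and so generates a contraction
semigroup, the limit of the exponentials of its Yosida approximations `n (n R(n) - 1)`
(`IsResolventFamily.exists_semigroup`). Uniqueness holds as norms decrease along differences of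
orbits (`IsC0Semigroup.eq_of_generatorGraph_eq`).

The invariance criterion. Invariance of `C` under the semigroup is equivalent to invariance under
`l R(l)` for large `l`: in one direction by a distance estimate (`mem_of_leavesInvariant`), in the
other since the exponential of a Yosida approximation is a limit of convex combinations of powers of
`n R(n)` (`exp_smul_sub_one_apply_mem`). Under invariance, the vectors `n R(n) Pψ` are bounded in
`V` and converge to `Pψ` in `H`, so `Pψ ∈ V`, and the inequality holds by weak lower
semicontinuity. Conversely, the inequality at `ψ = l R(l) f` with `f ∈ C` gives `ψ = Pψ`.

Direct sums. Each of the three properties is the invariance of the set of all `f` whose components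
take values in one closed convex set `K ∋ 0` of the complex plane: the real line, the half-line
`[0, ∞)`, the unit disc. The projection acts on components and pointwise, through the projection of
the plane onto `K`. Ellipticity with constants independent of the place shows that the projection
maps `⊕ V_i` to itself as soon as the criterion holds for every `a_{ii}` (`exists_lp_of_diag`).
The three characterizations then follow by expanding `a(Pψ, ψ - Pψ) = ∑ a_{ij}(Pψ_j, ψ_i - Pψ_i)`
and by testing with vectors that isolate single entries.
-/

noncomputable section

/-! ### Semigroups with a dissipative generator -/

section Semigroups

variable {H : Type*} [NormedAddCommGroup H] [InnerProductSpace ℂ H]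

theorem re_inner_self_eq (x : H) : (⟪x, x⟫_ℂ).re = ‖x‖ ^ 2 :=
  inner_self_eq_norm_sq (𝕜 := ℂ) x

/-- A curve whose right derivative is given by a dissipative operator has decreasing norm. Right
derivatives suffice, which is all that the generator of a semigroup provides directly. -/
theorem norm_le_of_re_inner_deriv_right_nonpos {f f' : ℝ → H}
    (hf : ContinuousOn f (Set.Ici 0))
    (hf' : ∀ t, 0 ≤ t → HasDerivWithinAt f (f' t) (Set.Ici t) t)
    (hre : ∀ t, 0 ≤ t → (⟪f' t, f t⟫_ℂ).re ≤ 0) {t : ℝ} (ht : 0 ≤ t) : ‖f t‖ ≤ ‖f 0‖ := by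
  let : InnerProductSpace ℝ H := InnerProductSpace.rclikeToReal ℂ H
  have key : ∀ x ∈ Set.Icc 0 t, ‖f x‖ ^ 2 ≤ ‖f 0‖ ^ 2 := by
    refine image_le_of_deriv_right_le_deriv_boundary (f := fun x => ‖f x‖ ^ 2)
      (f' := fun x => 2 * ⟪f x, f' x⟫_ℝ) (B := fun _ => ‖f 0‖ ^ 2) (B' := fun _ => 0)
      ?_ ?_ le_rfl continuousOn_const (fun x _ => hasDerivWithinAt_const _ _ _) ?_
    · exact ((hf.mono Set.Icc_subset_Ici_self).norm).pow 2
    · exact fun x hx => (hf' x hx.1).norm_sq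
    · intro x hx
      have := hre x hx.1
      rw [real_inner_comm]
      change 2 * (⟪f' x, f x⟫_ℂ).re ≤ 0
      linarith
  exact (sq_le_sq₀ (norm_nonneg _) (norm_nonneg _)).1 (key t ⟨ht, le_rfl⟩)

theorem tendsto_toNNReal_sub_nhdsGT (t : ℝ) :
    Tendsto (fun s : ℝ => (s - t).toNNReal) (𝓝[>] t) (𝓝[>] 0) := by
  refine tendsto_nhdsWithin_iff.2 ⟨?_, ?_⟩
  · have : Tendsto (fun s : ℝ => (s - t).toNNReal) (𝓝 t) (𝓝 (t - t).toNNReal) :=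
      (continuous_real_toNNReal.comp (continuous_id.sub continuous_const)).tendsto t
    simpa using this.mono_left nhdsWithin_le_nhds
  · filter_upwards [self_mem_nhdsWithin] with s hs
    simpa using hs

namespace IsC0Semigroup

variable {T : ℝ≥0 → (H →L[ℂ] H)}

theorem continuous_orbit_real (hT : IsC0Semigroup T) (x : H) :
    Continuous fun t : ℝ => T t.toNNReal x :=
  (hT.continuous_orbit x).comp continuous_real_toNNReal

theorem apply_comm (hT : IsC0Semigroup T) (s t : ℝ≥0) (x : H) : T s (T t x) = T t (T s x) := by
  rw [← mul_apply_eq_comp, ← hT.map_add, add_comm, hT.map_add,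
    mul_apply_eq_comp]

theorem orbit_mem_generatorGraph (hT : IsC0Semigroup T) {x y : H}
    (h : (x, y) ∈ generatorGraph T) (t : ℝ≥0) : (T t x, T t y) ∈ generatorGraph T := by
  have h1 := ((T t).continuous.tendsto y).comp h
  refine h1.congr fun s => ?_
  simp only [Function.comp]
  rw [hT.apply_comm s t, ← map_sub, ContinuousLinearMap.map_smul_of_tower]

theorem hasDerivWithinAt_orbit (hT : IsC0Semigroup T) {x y : H}
    (h : (x, y) ∈ generatorGraph T) {t : ℝ} (ht : 0 ≤ t) :
    HasDerivWithinAt (fun s : ℝ => T s.toNNReal x) (T t.toNNReal y) (Set.Ici t) t := by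
  rw [hasDerivWithinAt_iff_tendsto_slope, Set.Ici_sdiff_left]
  have h1 := (hT.orbit_mem_generatorGraph h t.toNNReal)
  have h2 := h1.comp (tendsto_toNNReal_sub_nhdsGT t)
  refine h2.congr' ?_
  filter_upwards [self_mem_nhdsWithin] with s hs
  have hs' : t < s := hs
  have e : s.toNNReal = (s - t).toNNReal + t.toNNReal := by
    rw [← Real.toNNReal_add (by linarith) ht]; simp
  simp only [Function.comp, slope_def_module, e, hT.map_add, mul_apply_eq_comp]
  rw [Real.coe_toNNReal _ (by linarith)]

end IsC0Semigroup

theorem generatorGraph_sub {T : ℝ≥0 → (H →L[ℂ] H)} {p q : H × H}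
    (hp : p ∈ generatorGraph T) (hq : q ∈ generatorGraph T) : p - q ∈ generatorGraph T := by
  refine (Tendsto.sub hp hq).congr fun h => ?_
  simp only [Prod.fst_sub, map_sub]
  rw [← smul_sub]; congr 1; abel

/-! ### Maximal dissipative operators -/

/-- `G` is the graph of a maximal dissipative operator `A`: `Re (A x | x) ≤ 0`, and `l - A` is
surjective. Surjectivity is only required for `l ≥ l₀`, which allows to use coercivity of shifted
forms with large shifts; the last field says that the relation `G` is single-valued. -/
structure IsMaximalDissipative (G : Submodule ℂ (H × H)) (l₀ : ℝ) : Prop where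
  pos : 0 < l₀
  dissipative : ∀ p ∈ G, (⟪p.2, p.1⟫_ℂ).re ≤ 0
  exists_mem : ∀ l, l₀ ≤ l → ∀ f : H, ∃ x : H, (x, l • x - f) ∈ G
  eq_zero : ∀ y, ((0 : H), y) ∈ G → y = 0

/-- `R l` is the resolvent `(l - A)⁻¹` for all `l ≥ l₀`, where `G` is the graph of `A`. -/
structure IsResolventFamily (G : Submodule ℂ (H × H)) (l₀ : ℝ) (R : ℝ → H →L[ℂ] H) : Prop where
  mem : ∀ l, l₀ ≤ l → ∀ f : H, (R l f, l • R l f - f) ∈ G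
  norm_le : ∀ l, l₀ ≤ l → ∀ f : H, ‖l • R l f‖ ≤ ‖f‖

namespace IsMaximalDissipative

variable {G : Submodule ℂ (H × H)} {l₀ : ℝ}

/-- The resolvent estimate `‖l x‖ ≤ ‖(l - A) x‖`. -/
theorem norm_smul_le (hG : IsMaximalDissipative G l₀) {l : ℝ} (hl : 0 ≤ l) {x y : H}
    (h : (x, y) ∈ G) : ‖l • x‖ ≤ ‖l • x - y‖ := by
  have h1 := hG.dissipative _ h
  have h2 : (⟪l • x - y, l • x⟫_ℂ).re = ‖l • x‖ ^ 2 - l * (⟪y, x⟫_ℂ).re := by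
    rw [inner_sub_left, Complex.sub_re, re_inner_self_eq, inner_smul_right_eq_smul, Complex.smul_re,
      smul_eq_mul]
  have h3 : (⟪l • x - y, l • x⟫_ℂ).re ≤ ‖l • x - y‖ * ‖l • x‖ := re_inner_le_norm (𝕜 := ℂ) _ _
  have h4 : l * (⟪y, x⟫_ℂ).re ≤ 0 := mul_nonpos_of_nonneg_of_nonpos hl h1
  rcases (norm_nonneg (l • x)).eq_or_lt with h0 | h0
  · rw [← h0]; positivity
  · nlinarith

theorem eq_of_mem (hG : IsMaximalDissipative G l₀) {l : ℝ} (hl : 0 < l) {x x' f : H}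
    (h : (x, l • x - f) ∈ G) (h' : (x', l • x' - f) ∈ G) : x = x' := by
  have h1 := hG.norm_smul_le hl.le (G.sub_mem h h')
  have : l • (x - x') - (l • x - f - (l • x' - f)) = 0 := by rw [smul_sub]; abel
  simp only [this, norm_zero, norm_le_zero_iff, smul_eq_zero, hl.ne', false_or, sub_eq_zero] at h1
  exact h1

theorem exists_resolventFamily (hG : IsMaximalDissipative G l₀) :
    ∃ R : ℝ → H →L[ℂ] H, IsResolventFamily G l₀ R := by
  have key : ∀ l : ℝ, ∃ S : H →L[ℂ] H, l₀ ≤ l →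
      (∀ f : H, (S f, l • S f - f) ∈ G) ∧ ∀ f : H, ‖l • S f‖ ≤ ‖f‖ := by
    intro l
    by_cases hl : l₀ ≤ l
    · have hl0 : 0 < l := hG.pos.trans_le hl
      choose r hr using hG.exists_mem l hl
      have hn : ∀ f, ‖l • r f‖ ≤ ‖f‖ := fun f => by
        simpa using hG.norm_smul_le hl0.le (hr f)
      let L : H →ₗ[ℂ] H :=
        { toFun := r
          map_add' := fun f g => hG.eq_of_mem hl0 (hr _) (by
            convert! G.add_mem (hr f) (hr g) using 1
            ext
            · rfl
            · simp only [Prod.snd_add, smul_add]; abel)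
          map_smul' := fun c f => hG.eq_of_mem hl0 (hr _) (by
            convert! G.smul_mem c (hr f) using 1
            ext
            · rfl
            · simp only [Prod.smul_snd, smul_sub, RingHom.id_apply, smul_comm c l]) }
      refine ⟨L.mkContinuous l⁻¹ fun f => ?_, fun _ => ⟨hr, hn⟩⟩
      have := hn f
      rw [norm_smul, Real.norm_of_nonneg hl0.le] at this
      rwa [← div_eq_inv_mul, le_div_iff₀' hl0]
    · exact ⟨0, fun h => absurd h hl⟩
  choose R hR using key
  exact ⟨R, fun l hl => (hR l hl).1, fun l hl => (hR l hl).2⟩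

/-- A vector orthogonal to the domain is `l x - A x` for some `x` in the domain, and dissipativity
then forces `x = 0`. -/
theorem dense_domain [CompleteSpace H] (hG : IsMaximalDissipative G l₀) :
    Dense {x : H | ∃ y, (x, y) ∈ G} := by
  have e : {x : H | ∃ y, (x, y) ∈ G} = (G.map (LinearMap.fst ℂ H H) : Set H) := by
    ext x; simp
  rw [e, Submodule.dense_iff_topologicalClosure_eq_top,
    Submodule.topologicalClosure_eq_top_iff, Submodule.eq_bot_iff]
  intro y hy
  obtain ⟨x, hx⟩ := hG.exists_mem l₀ le_rfl y
  have h1 : ⟪y, x⟫_ℂ = 0 := by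
    rw [inner_eq_zero_symm]
    exact hy x ⟨_, hx, rfl⟩
  have h2 := hG.dissipative _ hx
  have h3 := re_inner_self_eq x
  simp only [inner_sub_left, inner_smul_left_eq_smul, h1, sub_zero, Complex.smul_re,
    smul_eq_mul, h3] at h2
  have h4 : x = 0 := by
    have := (mul_nonpos_iff_pos_imp_nonpos.1 h2).1 hG.pos
    simpa using this
  subst h4
  simpa using hG.eq_zero _ hx

end IsMaximalDissipative

namespace IsResolventFamily

variable {G : Submodule ℂ (H × H)} {l₀ : ℝ} {R : ℝ → H →L[ℂ] H}

theorem apply_sub (hR : IsResolventFamily G l₀ R) (hG : IsMaximalDissipative G l₀) {l : ℝ}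
    (hl : l₀ ≤ l) {x y : H} (h : (x, y) ∈ G) : R l (l • x - y) = x :=
  hG.eq_of_mem (hG.pos.trans_le hl) (hR.mem l hl _) (by simpa using h)

/-- Resolvents commute, by the resolvent identity. -/
theorem commute (hR : IsResolventFamily G l₀ R) (hG : IsMaximalDissipative G l₀) {l m : ℝ}
    (hl : l₀ ≤ l) (hm : l₀ ≤ m) (f : H) : R l (R m f) = R m (R l f) := by
  have h1 := hR.mem l hl f
  have h2 := hR.mem m hm (R l f)
  have h3 : R m f = R l f + (l - m) • R m (R l f) := by
    have h4 := hR.apply_sub hG hm (G.add_mem h1 (G.smul_of_tower_mem (l - m) h2))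
    refine Eq.trans ?_ h4
    congr 1
    simp only [Prod.smul_mk]
    module
  rw [← hR.apply_sub hG hl h2, h3]
  congr 1
  rw [sub_smul]; abel

/-- On the domain, `n R(n) x - x = R(n) A x` is of order `1 / n`; as the operators `n R(n)` are
contractions, the convergence extends to the closure of the domain. -/
theorem tendsto_smul_apply [CompleteSpace H] (hR : IsResolventFamily G l₀ R)
    (hG : IsMaximalDissipative G l₀) (x : H) :
    Tendsto (fun n : ℕ => (n : ℝ) • R n x) atTop (𝓝 x) := by
  have hev : ∀ᶠ n : ℕ in atTop, l₀ ≤ n := tendsto_natCast_atTop_atTop.eventually_ge_atTop l₀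
  rw [Metric.tendsto_nhds]
  intro ε hε
  obtain ⟨z, hz, y, hzy⟩ := Metric.dense_iff.1 hG.dense_domain x (ε / 3) (by positivity)
  have h1 : Tendsto (fun n : ℕ => ‖y‖ * (n : ℝ)⁻¹) atTop (𝓝 (‖y‖ * 0)) :=
    tendsto_inv_atTop_nhds_zero_nat.const_mul _
  rw [mul_zero] at h1
  have h2 := h1.eventually (gt_mem_nhds (show (0 : ℝ) < ε / 3 by positivity))
  filter_upwards [h2, hev] with n hn hl
  have hn0 : (0 : ℝ) < n := hG.pos.trans_le hl
  rw [Metric.mem_ball, dist_comm, dist_eq_norm] at hz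
  have e1 : (n : ℝ) • R n z - z = R n y := by
    have := hR.apply_sub hG hl hzy
    rw [map_sub, ContinuousLinearMap.map_smul_of_tower] at this
    rw [sub_eq_iff_eq_add, ← sub_eq_iff_eq_add', this]
  have e2 : ‖R n y‖ ≤ ‖y‖ * (n : ℝ)⁻¹ := by
    have := hR.norm_le n hl y
    rw [norm_smul, Real.norm_of_nonneg hn0.le] at this
    rw [← div_eq_mul_inv, le_div_iff₀' hn0]; exact this
  have e3 : (n : ℝ) • R n x - x = (n : ℝ) • R n (x - z) + (R n y - (x - z)) := by
    rw [← e1, map_sub, smul_sub]; abel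
  rw [dist_eq_norm, e3]
  have e4 := hR.norm_le n hl (x - z)
  have e5 := norm_add_le ((n : ℝ) • R n (x - z)) (R n y - (x - z))
  have e6 := norm_sub_le (R n y) (x - z)
  linarith

end IsResolventFamily

namespace IsC0Semigroup

variable {T S : ℝ≥0 → (H →L[ℂ] H)} {G : Submodule ℂ (H × H)} {l₀ : ℝ}

/-- A semigroup with dissipative generator is contractive: the norm decreases along the orbits that
start in the domain. -/
theorem norm_apply_le [CompleteSpace H] (hT : IsC0Semigroup T) (hG : IsMaximalDissipative G l₀)
    (hTG : generatorGraph T = G) (t : ℝ≥0) (x : H) : ‖T t x‖ ≤ ‖x‖ := by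
  have hc : IsClosed {x : H | ‖T t x‖ ≤ ‖x‖} :=
    isClosed_le (T t).continuous.norm continuous_norm
  refine hc.closure_subset_iff.2 ?_ (hG.dense_domain x)
  rintro z ⟨y, hzy⟩
  have hz : (z, y) ∈ generatorGraph T := by rw [hTG]; exact hzy
  have := norm_le_of_re_inner_deriv_right_nonpos (f := fun s : ℝ => T s.toNNReal z)
    (hT.continuous_orbit_real z).continuousOn (fun s hs => hT.hasDerivWithinAt_orbit hz hs)
    (fun s hs => hG.dissipative (T s.toNNReal z, T s.toNNReal y) (by
      have := hT.orbit_mem_generatorGraph hz s.toNNReal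
      rwa [hTG] at this)) t.2
  simpa [hT.map_zero] using this

/-- The generator determines the semigroup: the difference of two orbits starting at the same point
of the domain solves the evolution equation with initial value `0`. -/
theorem eq_of_generatorGraph_eq [CompleteSpace H] (hT : IsC0Semigroup T) (hS : IsC0Semigroup S)
    (hG : IsMaximalDissipative G l₀) (hTG : generatorGraph T = G) (hSG : generatorGraph S = G) :
    T = S := by
  funext t
  ext x
  have hc : IsClosed {x : H | T t x = S t x} := isClosed_eq (T t).continuous (S t).continuous
  refine hc.closure_subset_iff.2 ?_ (hG.dense_domain x)
  rintro z ⟨y, hzy⟩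
  have hz : (z, y) ∈ generatorGraph T := by rw [hTG]; exact hzy
  have hz' : (z, y) ∈ generatorGraph S := by rw [hSG]; exact hzy
  have := norm_le_of_re_inner_deriv_right_nonpos
    (f := fun s : ℝ => T s.toNNReal z - S s.toNNReal z)
    ((hT.continuous_orbit_real z).sub (hS.continuous_orbit_real z)).continuousOn
    (fun s hs => (hT.hasDerivWithinAt_orbit hz hs).sub (hS.hasDerivWithinAt_orbit hz' hs))
    (fun s hs => hG.dissipative
        ((T s.toNNReal z, T s.toNNReal y) - (S s.toNNReal z, S s.toNNReal y)) (by
      have h1 := hT.orbit_mem_generatorGraph hz s.toNNReal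
      have h2 := hS.orbit_mem_generatorGraph hz' s.toNNReal
      rw [hTG] at h1
      rw [hSG] at h2
      exact G.sub_mem h1 h2)) t.2
  simpa [hT.map_zero, hS.map_zero, sub_eq_zero] using this

end IsC0Semigroup

end Semigroups

/-! ### The Hille–Yosida theorem -/

section Yosida

variable {H : Type*} [NormedAddCommGroup H] [InnerProductSpace ℂ H]

/-- The Yosida approximation `l (l R(l) - 1)` of an operator with resolvent `R`. -/
def yosida (R : ℝ → H →L[ℂ] H) (l : ℝ) : H →L[ℂ] H := l • (l • R l - 1)

theorem yosida_apply_eq (R : ℝ → H →L[ℂ] H) (l : ℝ) (x : H) :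
    yosida R l x = l • (l • R l x - x) := by
  simp [yosida]

variable {G : Submodule ℂ (H × H)} {l₀ : ℝ} {R : ℝ → H →L[ℂ] H}

theorem IsResolventFamily.yosida_dissipative (hR : IsResolventFamily G l₀ R)
    (hG : IsMaximalDissipative G l₀) {l : ℝ} (hl : l₀ ≤ l) (x : H) :
    (⟪yosida R l x, x⟫_ℂ).re ≤ 0 := by
  have h1 : (⟪l • R l x, x⟫_ℂ).re ≤ ‖l • R l x‖ * ‖x‖ := re_inner_le_norm (𝕜 := ℂ) _ _
  have h2 := hR.norm_le l hl x
  have h3 := re_inner_self_eq x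
  rw [yosida_apply_eq, inner_smul_left_eq_smul, Complex.smul_re, inner_sub_left, Complex.sub_re, h3]
  refine mul_nonpos_of_nonneg_of_nonpos (hG.pos.le.trans hl) ?_
  nlinarith [norm_nonneg x]

theorem IsResolventFamily.yosida_commute (hR : IsResolventFamily G l₀ R)
    (hG : IsMaximalDissipative G l₀) {l m : ℝ} (hl : l₀ ≤ l) (hm : l₀ ≤ m) :
    Commute (yosida R l) (yosida R m) := by
  have h : Commute (R l) (R m) := by
    ext x; exact hR.commute hG hl hm x
  have h1 : Commute (l • R l - 1) (m • R m - 1) :=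
    (((h.smul_left l).smul_right m).sub_right (Commute.one_right _)).sub_left (Commute.one_left _)
  exact (h1.smul_left l).smul_right m

/-- On the domain, the Yosida approximation is `l R(l) A`. -/
theorem IsResolventFamily.yosida_apply (hR : IsResolventFamily G l₀ R)
    (hG : IsMaximalDissipative G l₀) {l : ℝ} (hl : l₀ ≤ l) {x y : H} (h : (x, y) ∈ G) :
    yosida R l x = l • R l y := by
  have := hR.apply_sub hG hl h
  rw [map_sub, ContinuousLinearMap.map_smul_of_tower] at this
  rw [yosida_apply_eq]
  congr 1
  rw [sub_eq_iff_eq_add, ← sub_eq_iff_eq_add', this]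

end Yosida

section Generation

variable {H : Type*} [NormedAddCommGroup H] [InnerProductSpace ℂ H] [CompleteSpace H]

open NormedSpace (exp)

theorem hasDerivAt_exp_smul_apply (A : H →L[ℂ] H) (x : H) (t : ℝ) :
    HasDerivAt (fun s : ℝ => exp (s • A) x) (exp (t • A) (A x)) t :=
  ((ContinuousLinearMap.apply ℂ H x).restrictScalars ℝ).hasFDerivAt.comp_hasDerivAt t
    (hasDerivAt_exp_smul_const A t)

theorem exp_smul_apply_comm {A B : H →L[ℂ] H} (h : Commute A B) (t : ℝ) (x : H) :
    exp (t • A) (B x) = B (exp (t • A) x) := by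
  have : Commute (exp (t • A)) B := (h.smul_left t).exp_left
  exact DFunLike.congr_fun this.eq x

theorem continuous_exp_smul_apply (A : H →L[ℂ] H) (x : H) :
    Continuous fun s : ℝ => exp (s • A) x :=
  continuous_iff_continuousAt.2 fun t => (hasDerivAt_exp_smul_apply A x t).continuousAt

theorem norm_exp_smul_apply_le {A : H →L[ℂ] H} (hA : ∀ x, (⟪A x, x⟫_ℂ).re ≤ 0) {t : ℝ}
    (ht : 0 ≤ t) (x : H) : ‖exp (t • A) x‖ ≤ ‖x‖ := by
  have := norm_le_of_re_inner_deriv_right_nonpos (f := fun s : ℝ => exp (s • A) x)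
    (continuous_exp_smul_apply A x).continuousOn
    (fun s _ => (hasDerivAt_exp_smul_apply A x s).hasDerivWithinAt)
    (fun s _ => by rw [exp_smul_apply_comm (Commute.refl A)]; exact hA _) ht
  simpa using this

/-- Two commuting contraction semigroups are compared through the derivative of
`s ↦ exp (s A) exp ((t - s) B)`. -/
theorem norm_exp_smul_apply_sub_le {A B : H →L[ℂ] H} (hA : ∀ x, (⟪A x, x⟫_ℂ).re ≤ 0)
    (hB : ∀ x, (⟪B x, x⟫_ℂ).re ≤ 0) (hAB : Commute A B) {t : ℝ} (ht : 0 ≤ t) (x : H) :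
    ‖exp (t • A) x - exp (t • B) x‖ ≤ t * ‖A x - B x‖ := by
  have h1 : ∀ s : ℝ, HasDerivAt (fun s : ℝ => exp (s • A) (exp ((t - s) • B) x))
      (exp (s • A) (exp ((t - s) • B) (A x - B x))) s := by
    intro s
    have hb : HasDerivAt (fun s : ℝ => exp ((t - s) • B)) (-(B * exp ((t - s) • B))) s := by
      have := (hasDerivAt_exp_smul_const' B (t - s)).scomp s ((hasDerivAt_id s).const_sub t)
      simpa [Function.comp_def] using! this
    have h := ((ContinuousLinearMap.apply ℂ H x).restrictScalars ℝ).hasFDerivAt.comp_hasDerivAt s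
      ((hasDerivAt_exp_smul_const A s).mul hb)
    convert! h using 1
    have e := exp_smul_apply_comm hAB.symm (t - s) x
    have e' := exp_smul_apply_comm (Commute.refl B) (t - s) x
    simp only [map_sub, e, e']
    simp [sub_eq_add_neg]
  have h2 := norm_image_sub_le_of_norm_deriv_le_segment' (a := 0) (b := t)
    (f := fun s : ℝ => exp (s • A) (exp ((t - s) • B) x)) (C := ‖A x - B x‖)
    (fun s _ => (h1 s).hasDerivWithinAt)
    (fun s hs => (norm_exp_smul_apply_le hA hs.1 _).trans
      (norm_exp_smul_apply_le hB (sub_nonneg.2 hs.2.le) _)) t ⟨ht, le_rfl⟩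
  simpa [mul_comm] using h2

section Approximation

variable {A : ℕ → H →L[ℂ] H} {D : Set H}

/-- The approximating semigroups converge locally uniformly in time. -/
theorem exists_forall_norm_exp_smul_sub_le (hdiss : ∀ n x, (⟪A n x, x⟫_ℂ).re ≤ 0)
    (hcomm : ∀ m n, Commute (A m) (A n)) (hD : Dense D)
    (hlim : ∀ x ∈ D, ∃ y, Tendsto (fun n => A n x) atTop (𝓝 y)) (x : H) (b : ℝ) {ε : ℝ}
    (hε : 0 < ε) : ∃ N, ∀ m ≥ N, ∀ n ≥ N, ∀ t ∈ Set.Icc 0 b,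
      ‖exp (t • A m) x - exp (t • A n) x‖ ≤ ε := by
  obtain ⟨z, hz, hzD⟩ := Metric.dense_iff.1 hD x (ε / 3) (by positivity)
  obtain ⟨y, hy⟩ := hlim z hzD
  have hb : 0 < |b| + 1 := by positivity
  obtain ⟨N, hN⟩ := Metric.cauchySeq_iff.1 hy.cauchySeq (ε / 3 / (|b| + 1)) (by positivity)
  refine ⟨N, fun m hm n hn t ht => ?_⟩
  have h1 := norm_exp_smul_apply_sub_le (hdiss m) (hdiss n) (hcomm m n) ht.1 z
  have h2 := norm_exp_smul_apply_le (hdiss m) ht.1 (x - z)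
  have h3 := norm_exp_smul_apply_le (hdiss n) ht.1 (x - z)
  have h4 : t * ‖A m z - A n z‖ ≤ ε / 3 := by
    have := hN m hm n hn
    rw [dist_eq_norm, lt_div_iff₀ hb] at this
    have ht' : t ≤ |b| + 1 := ht.2.trans ((le_abs_self b).trans (by linarith))
    nlinarith [norm_nonneg (A m z - A n z)]
  rw [Metric.mem_ball, dist_comm, dist_eq_norm] at hz
  have e : exp (t • A m) x - exp (t • A n) x
      = (exp (t • A m) z - exp (t • A n) z) + (exp (t • A m) (x - z) - exp (t • A n) (x - z)) := by
    simp only [map_sub]; abel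
  rw [e]
  have h5 := norm_add_le (exp (t • A m) z - exp (t • A n) z)
    (exp (t • A m) (x - z) - exp (t • A n) (x - z))
  have h6 := norm_sub_le (exp (t • A m) (x - z)) (exp (t • A n) (x - z))
  linarith

/-- Commuting bounded dissipative operators that converge strongly on a dense set generate
semigroups that converge strongly to a semigroup, whose generator extends the limit. -/
theorem exists_semigroup_of_tendsto (hdiss : ∀ n x, (⟪A n x, x⟫_ℂ).re ≤ 0)
    (hcomm : ∀ m n, Commute (A m) (A n)) (hD : Dense D)
    (hlim : ∀ x ∈ D, ∃ y, Tendsto (fun n => A n x) atTop (𝓝 y)) :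
    ∃ T : ℝ≥0 → (H →L[ℂ] H), IsC0Semigroup T ∧
      (∀ (t : ℝ≥0) x, Tendsto (fun n => exp ((t : ℝ) • A n) x) atTop (𝓝 (T t x))) ∧
      ∀ x y, Tendsto (fun n => A n x) atTop (𝓝 y) → (x, y) ∈ generatorGraph T := by
  have hC := exists_forall_norm_exp_smul_sub_le hdiss hcomm hD hlim
  have hconv : ∀ (t : ℝ≥0) (x : H), ∃ y, Tendsto (fun n => exp ((t : ℝ) • A n) x) atTop (𝓝 y) := by
    intro t x
    refine cauchySeq_tendsto_of_complete (Metric.cauchySeq_iff.2 fun ε hε => ?_)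
    obtain ⟨N, hN⟩ := hC x t (half_pos hε)
    refine ⟨N, fun m hm n hn => ?_⟩
    rw [dist_eq_norm]
    exact (hN m hm n hn t ⟨t.2, le_rfl⟩).trans_lt (half_lt_self hε)
  choose L hL using hconv
  have hLn : ∀ t x, ‖L t x‖ ≤ 1 * ‖x‖ := fun t x => by
    rw [one_mul]
    exact le_of_tendsto (hL t x).norm
      (Eventually.of_forall fun n => norm_exp_smul_apply_le (hdiss n) t.2 x)
  let T : ℝ≥0 → (H →L[ℂ] H) := fun t => LinearMap.mkContinuous
    { toFun := L t
      map_add' := fun x y => tendsto_nhds_unique (hL t _)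
        (((hL t x).add (hL t y)).congr fun n => (map_add _ _ _).symm)
      map_smul' := fun c x => tendsto_nhds_unique (hL t _)
        (((hL t x).const_smul c).congr fun n => (map_smul _ _ _).symm) } 1 (hLn t)
  have hT : ∀ (t : ℝ≥0) x, Tendsto (fun n => exp ((t : ℝ) • A n) x) atTop (𝓝 (T t x)) := hL
  have hT0 : T 0 = 1 := by
    ext x
    refine tendsto_nhds_unique (hT 0 x) ?_
    simp
  have hTunif : ∀ (x : H) (b : ℝ) (ε : ℝ), 0 < ε → ∃ N, ∀ n ≥ N, ∀ t : ℝ≥0, (t : ℝ) ≤ b →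
      ‖T t x - exp ((t : ℝ) • A n) x‖ ≤ ε := by
    intro x b ε hε
    obtain ⟨N, hN⟩ := hC x b hε
    refine ⟨N, fun n hn t ht => le_of_tendsto ((hT t x).sub_const _).norm ?_⟩
    filter_upwards [eventually_ge_atTop N] with m hm
    exact hN m hm n hn t ⟨t.2, ht⟩
  have hTcont : ∀ x, Continuous fun t : ℝ≥0 => T t x := by
    intro x
    have : TendstoLocallyUniformly (fun n (t : ℝ≥0) => exp ((t : ℝ) • A n) x)
        (fun t => T t x) atTop := by
      rw [Metric.tendstoLocallyUniformly_iff]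
      intro ε hε t
      obtain ⟨N, hN⟩ := hTunif x (t + 1) (ε / 2) (half_pos hε)
      refine ⟨Set.Iio (t + 1), Iio_mem_nhds (by simp), ?_⟩
      filter_upwards [eventually_ge_atTop N] with n hn s hs
      rw [dist_eq_norm]
      have hs' : s < t + 1 := hs
      exact (hN n hn s (by exact_mod_cast hs'.le)).trans_lt (half_lt_self hε)
    exact this.continuous (Frequently.of_forall fun n =>
      (continuous_exp_smul_apply (A n) x).comp NNReal.continuous_coe)
  have hTadd : ∀ s t, T (s + t) = T s * T t := by
    intro s t
    ext x
    refine tendsto_nhds_unique (hT (s + t) x) ?_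
    have h1 : Tendsto (fun n => exp ((s : ℝ) • A n) (T t x)
        - exp ((s : ℝ) • A n) (T t x - exp ((t : ℝ) • A n) x)) atTop (𝓝 (T s (T t x) - 0)) := by
      refine (hT s (T t x)).sub (squeeze_zero_norm
        (fun n => norm_exp_smul_apply_le (hdiss n) s.2 _) ?_)
      simpa using ((tendsto_const_nhds (x := T t x)).sub (hT t x)).norm
    rw [sub_zero] at h1
    refine h1.congr fun n => ?_
    have e : exp (((s + t : ℝ≥0) : ℝ) • A n) = exp ((s : ℝ) • A n) * exp ((t : ℝ) • A n) := by
      let : NormedAlgebra ℚ (H →L[ℂ] H) := NormedAlgebra.restrictScalars ℚ ℝ _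
      rw [NNReal.coe_add, add_smul, NormedSpace.exp_add_of_commute]
      exact ((Commute.refl (A n)).smul_left _).smul_right _
    rw [e, ← map_sub, sub_sub_cancel, mul_apply_eq_comp]
  refine ⟨T, ⟨hT0, hTadd, hTcont⟩, hT, fun x y hxy => ?_⟩
  -- `‖T h x - x - h y‖ ≤ 3 ε h` for small `h`, by the mean value inequality for `exp (h A n) x`
  refine Metric.tendsto_nhds.2 fun ε hε => ?_
  have hε' : 0 < ε / 4 := by positivity
  have hy0 : ∀ᶠ s : ℝ≥0 in 𝓝 0, ‖T s y - y‖ < ε / 4 := by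
    have := ((hTcont y).tendsto 0).sub_const y |>.norm
    simp only [hT0, one_apply_eq_self, sub_self, norm_zero] at this
    exact this.eventually (gt_mem_nhds hε')
  obtain ⟨δ, hδ, hδy⟩ := (NNReal.nhds_zero_basis.eventually_iff).1 hy0
  have hsmall : ∀ᶠ h : ℝ≥0 in 𝓝[>] 0, h < δ := nhdsWithin_le_nhds (Iio_mem_nhds hδ)
  filter_upwards [hsmall, self_mem_nhdsWithin] with h hhδ hh0
  have hh0' : (0 : ℝ) < h := hh0
  obtain ⟨N, hN⟩ := hTunif y δ (ε / 4) hε'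
  have hmain : ‖T h x - x - (h : ℝ) • y‖ ≤ 3 * (ε / 4) * h := by
    have h1 : Tendsto (fun n => exp ((h : ℝ) • A n) x - x - (h : ℝ) • A n x) atTop
        (𝓝 (T h x - x - (h : ℝ) • y)) := ((hT h x).sub_const x).sub (hxy.const_smul _)
    refine le_of_tendsto h1.norm ?_
    have h2 : ∀ᶠ n in atTop, ‖A n x - y‖ < ε / 8 := by
      have := (hxy.sub_const y).norm
      simp only [sub_self, norm_zero] at this
      exact this.eventually (gt_mem_nhds (by positivity))
    filter_upwards [h2, eventually_ge_atTop N] with n hn hnN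
    have h3 : ∀ s ∈ Set.Icc (0 : ℝ) h, HasDerivWithinAt
        (fun s : ℝ => exp (s • A n) x - s • A n x) (exp (s • A n) (A n x) - A n x)
        (Set.Icc 0 (h : ℝ)) s := by
      intro s _
      have := ((hasDerivAt_exp_smul_apply (A n) x s).sub
        ((hasDerivAt_id s).smul_const (A n x))).hasDerivWithinAt (s := Set.Icc 0 (h : ℝ))
      simpa using! this
    have h4 : ∀ s ∈ Set.Ico (0 : ℝ) h, ‖exp (s • A n) (A n x) - A n x‖ ≤ 3 * (ε / 4) := by
      intro s hs
      lift s to ℝ≥0 using hs.1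
      have hsδ : s < δ := lt_trans (by exact_mod_cast hs.2) hhδ
      have k1 := hN n hnN s (by exact_mod_cast hsδ.le)
      have k2 := hδy hsδ
      have k3 := norm_exp_smul_apply_le (hdiss n) s.2 (A n x - y)
      have e : exp ((s : ℝ) • A n) (A n x) - A n x = exp ((s : ℝ) • A n) (A n x - y)
          + ((T s y - y) - (T s y - exp ((s : ℝ) • A n) y) - (A n x - y)) := by
        rw [map_sub]; abel
      rw [e]
      have n1 := norm_add_le (exp ((s : ℝ) • A n) (A n x - y))
        ((T s y - y) - (T s y - exp ((s : ℝ) • A n) y) - (A n x - y))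
      have n2 := norm_sub_le ((T s y - y) - (T s y - exp ((s : ℝ) • A n) y)) (A n x - y)
      have n3 := norm_sub_le (T s y - y) (T s y - exp ((s : ℝ) • A n) y)
      change ‖exp ((s : ℝ) • A n) (A n x - y)‖ ≤ _ at k3
      linarith
    have h5 := norm_image_sub_le_of_norm_deriv_le_segment' h3 h4 h ⟨hh0'.le, le_rfl⟩
    simp only [zero_smul, NormedSpace.exp_zero, one_apply_eq_self, sub_zero] at h5
    rwa [sub_right_comm]
  rw [dist_eq_norm]
  have e : (h : ℝ)⁻¹ • (T h x - x) - y = (h : ℝ)⁻¹ • (T h x - x - (h : ℝ) • y) := by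
    rw [smul_sub _ (T h x - x), inv_smul_smul₀ hh0'.ne']
  simp only [e, norm_smul, norm_inv, Real.norm_of_nonneg hh0'.le]
  rw [inv_mul_lt_iff₀ hh0']
  nlinarith

end Approximation

variable {G : Submodule ℂ (H × H)} {l₀ : ℝ} {R : ℝ → H →L[ℂ] H}

/-- The **Hille–Yosida theorem** for maximal dissipative operators on a Hilbert space, together
with the convergence of the Yosida approximations. -/
theorem IsResolventFamily.exists_semigroup (hR : IsResolventFamily G l₀ R)
    (hG : IsMaximalDissipative G l₀) :
    ∃ T : ℝ≥0 → (H →L[ℂ] H), IsC0Semigroup T ∧ generatorGraph T = G ∧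
      ∀ (t : ℝ≥0) x, Tendsto (fun n : ℕ => exp ((t : ℝ) • yosida R n) x) atTop (𝓝 (T t x)) := by
  obtain ⟨N, hN⟩ := exists_nat_ge l₀
  have hNk : ∀ k : ℕ, l₀ ≤ ((k + N : ℕ) : ℝ) := fun k => hN.trans (by exact_mod_cast (by omega))
  have hlim : ∀ x y, (x, y) ∈ G →
      Tendsto (fun k : ℕ => yosida R ((k + N : ℕ) : ℝ) x) atTop (𝓝 y) := fun x y h =>
    ((tendsto_add_atTop_iff_nat N).2 (hR.tendsto_smul_apply hG y)).congr fun k =>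
      (hR.yosida_apply hG (hNk k) h).symm
  obtain ⟨T, hT, hTlim, hTG⟩ := exists_semigroup_of_tendsto
    (A := fun k : ℕ => yosida R ((k + N : ℕ) : ℝ))
    (fun k x => hR.yosida_dissipative hG (hNk k) x)
    (fun k m => hR.yosida_commute hG (hNk k) (hNk m)) hG.dense_domain
    (fun x ⟨y, hy⟩ => ⟨y, hlim x y hy⟩)
  have hcontr : ∀ (t : ℝ≥0) x, ‖T t x‖ ≤ ‖x‖ := fun t x => le_of_tendsto (hTlim t x).norm
    (Eventually.of_forall fun k =>
      norm_exp_smul_apply_le (fun x => hR.yosida_dissipative hG (hNk k) x) t.2 x)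
  have hTdiss : ∀ p ∈ generatorGraph T, (⟪p.2, p.1⟫_ℂ).re ≤ 0 := by
    intro p hp
    have h1 : Tendsto (fun h : ℝ≥0 => (⟪(h : ℝ)⁻¹ • (T h p.1 - p.1), p.1⟫_ℂ).re) (𝓝[>] 0)
        (𝓝 (⟪p.2, p.1⟫_ℂ).re) :=
      (Complex.continuous_re.tendsto _).comp (Tendsto.inner hp tendsto_const_nhds)
    refine le_of_tendsto h1 (Eventually.of_forall fun h => ?_)
    have h3 := re_inner_self_eq p.1
    have h4 : (⟪T h p.1, p.1⟫_ℂ).re ≤ ‖T h p.1‖ * ‖p.1‖ := re_inner_le_norm (𝕜 := ℂ) _ _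
    rw [inner_smul_left_eq_smul, Complex.smul_re, inner_sub_left, Complex.sub_re, h3]
    refine mul_nonpos_of_nonneg_of_nonpos (by positivity) ?_
    nlinarith [hcontr h p.1, norm_nonneg p.1]
  have hsub : (G : Set (H × H)) ⊆ generatorGraph T := fun p hp => hTG _ _ (hlim _ _ hp)
  refine ⟨T, hT, Set.Subset.antisymm ?_ hsub,
    fun t x => (tendsto_add_atTop_iff_nat N).1 (hTlim t x)⟩
  -- a dissipative extension of a maximal dissipative operator is not proper
  rintro ⟨x, y⟩ hxy
  have h1 := hR.mem l₀ le_rfl (l₀ • x - y)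
  have h2 := hTdiss _ (generatorGraph_sub hxy (hsub h1))
  set z := R l₀ (l₀ • x - y) with hz
  have e : y - (l₀ • z - (l₀ • x - y)) = l₀ • (x - z) := by rw [smul_sub]; abel
  simp only [Prod.mk_sub_mk, e] at h2
  have h3 := re_inner_self_eq (x - z)
  rw [inner_smul_left_eq_smul, Complex.smul_re, h3, smul_eq_mul] at h2
  have h4 : x - z = 0 := by
    have := (mul_nonpos_iff_pos_imp_nonpos.1 h2).1 hG.pos
    simpa using this
  rw [sub_eq_zero] at h4
  rw [← h4, sub_sub_cancel] at h1
  exact h1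

end Generation

/-! ### Operators associated with forms -/

section FormOperators

variable {H : Type*} [NormedAddCommGroup H] [InnerProductSpace ℂ H]
variable {V : Type*} [NormedAddCommGroup V] [InnerProductSpace ℂ V]

theorem FormContinuous.exists_nonneg {a : V →ₗ[ℂ] V →ₗ⋆[ℂ] ℂ} (ha : FormContinuous a) :
    ∃ M : ℝ, 0 ≤ M ∧ ∀ ψ ψ' : V, ‖a ψ ψ'‖ ≤ M * ‖ψ‖ * ‖ψ'‖ := by
  obtain ⟨M, hM⟩ := ha
  refine ⟨max M 0, le_max_right _ _, fun ψ ψ' => (hM ψ ψ').trans ?_⟩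
  gcongr
  exact le_max_left _ _

/-- A continuous form with its second variable frozen, as an element of the dual of `V`. -/
theorem FormContinuous.exists_dual_left {a : V →ₗ[ℂ] V →ₗ⋆[ℂ] ℂ} (ha : FormContinuous a) (v : V) :
    ∃ L : V →L[ℂ] ℂ, ∀ ψ, L ψ = a ψ v := by
  obtain ⟨M, -, hM⟩ := ha.exists_nonneg
  exact ⟨LinearMap.mkContinuous
    { toFun := fun ψ => a ψ v
      map_add' := fun x y => by simp
      map_smul' := fun c x => by simp } (M * ‖v‖) (fun ψ => (hM ψ v).trans_eq (by ring)),
    fun _ => rfl⟩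

/-- A continuous form with its first variable frozen is antilinear; its conjugate is an element of
the dual of `V`. -/
theorem FormContinuous.exists_dual_right {a : V →ₗ[ℂ] V →ₗ⋆[ℂ] ℂ} (ha : FormContinuous a)
    (v : V) : ∃ L : V →L[ℂ] ℂ, ∀ ψ, L ψ = (starRingEnd ℂ) (a v ψ) := by
  obtain ⟨M, -, hM⟩ := ha.exists_nonneg
  exact ⟨LinearMap.mkContinuous
    { toFun := fun ψ => (starRingEnd ℂ) (a v ψ)
      map_add' := fun x y => by simp
      map_smul' := fun c x => by simp } (M * ‖v‖) (fun ψ => by simpa using hM v ψ),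
    fun _ => rfl⟩

/-- The **Lax–Milgram theorem** for sesquilinear forms. -/
theorem FormContinuous.exists_forall_eq_inner [CompleteSpace V] {a : V →ₗ[ℂ] V →ₗ⋆[ℂ] ℂ}
    (ha : FormContinuous a) {c : ℝ} (hc : 0 < c) (hcoer : ∀ ψ, c * ‖ψ‖ ^ 2 ≤ (a ψ ψ).re) (f : V) :
    ∃ ψ : V, ∀ v, a ψ v = ⟪v, f⟫_ℂ := by
  obtain ⟨M, -, hM⟩ := ha.exists_nonneg
  let b : V →L⋆[ℂ] V →L[ℂ] ℂ := LinearMap.mkContinuous₂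
    (LinearMap.mk₂'ₛₗ (starRingEnd ℂ) (RingHom.id ℂ) (fun v w => (starRingEnd ℂ) (a v w))
      (by simp) (by simp) (by simp) (by simp)) M (fun v w => by simpa using hM v w)
  let B : V →L[ℂ] V := InnerProductSpace.continuousLinearMapOfBilin b
  have hB : ∀ ψ v, a ψ v = ⟪v, B ψ⟫_ℂ := fun ψ v => by
    rw [← inner_conj_symm, InnerProductSpace.continuousLinearMapOfBilin_apply]
    exact (Complex.conj_conj _).symm
  have hlow : ∀ ψ, c * ‖ψ‖ ≤ ‖B ψ‖ := by
    intro ψ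
    have h1 := hcoer ψ
    rw [hB] at h1
    have h2 : (⟪ψ, B ψ⟫_ℂ).re ≤ ‖ψ‖ * ‖B ψ‖ := re_inner_le_norm (𝕜 := ℂ) _ _
    rcases (norm_nonneg ψ).eq_or_lt with h0 | h0
    · rw [← h0, mul_zero]; positivity
    · nlinarith
  have hanti : AntilipschitzWith c⁻¹.toNNReal B := by
    refine ContinuousLinearMap.antilipschitz_of_bound B fun ψ => ?_
    rw [Real.coe_toNNReal _ (inv_nonneg.2 hc.le), ← div_eq_inv_mul, le_div_iff₀' hc]
    exact hlow ψ
  have hclosed : IsClosed (B.range : Set V) := hanti.isClosed_range B.uniformContinuous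
  have := hclosed.completeSpace_coe
  have htop : B.range = ⊤ := by
    rw [← Submodule.orthogonal_orthogonal B.range, Submodule.eq_top_iff']
    intro v w hw
    have hw0 : ⟪B w, w⟫_ℂ = 0 := hw _ ⟨w, rfl⟩
    have h0 : a w w = 0 := by rw [hB, ← inner_conj_symm, hw0, map_zero]
    have h1 := hcoer w
    rw [h0, Complex.zero_re] at h1
    have : w = 0 := by
      have := (mul_nonpos_iff_pos_imp_nonpos.1 h1).1 hc
      simpa using this
    rw [this, inner_zero_left]
  obtain ⟨ψ, hψ⟩ : f ∈ B.range := by rw [htop]; trivial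
  have hψ' : B ψ = f := hψ
  exact ⟨ψ, fun v => by rw [hB, hψ']⟩

variable (J : V →L[ℂ] H) (a : V →ₗ[ℂ] V →ₗ⋆[ℂ] ℂ)

/-- The graph of the operator associated with a form, as a subspace of `H × H`. -/
def formGraph : Submodule ℂ (H × H) where
  carrier := formOperatorGraph J a
  zero_mem' := ⟨0, by simp, 0, by simp, by simp⟩
  add_mem' := by
    rintro p q ⟨ψ, h1, f, h2, h3⟩ ⟨ψ', h1', f', h2', h3'⟩
    refine ⟨ψ + ψ', by simp [h1, h1'], f + f', fun v => ?_, ?_⟩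
    · rw [map_add, LinearMap.add_apply, h2, h2', inner_add_right]
    · rw [Prod.snd_add, h3, h3', neg_add]
  smul_mem' := by
    rintro c p ⟨ψ, h1, f, h2, h3⟩
    refine ⟨c • ψ, by simp [h1], c • f, fun v => ?_, ?_⟩
    · rw [map_smul, LinearMap.smul_apply, h2, inner_smul_right, smul_eq_mul]
    · rw [Prod.smul_snd, h3, smul_neg]

/-- The form `a(ψ,ψ') + l (ψ | ψ')_H`. -/
def shiftedForm (l : ℝ) : V →ₗ[ℂ] V →ₗ⋆[ℂ] ℂ :=
  a + LinearMap.mk₂'ₛₗ (RingHom.id ℂ) (starRingEnd ℂ) (fun ψ v => (l : ℂ) * ⟪J v, J ψ⟫_ℂ)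
    (fun _ _ _ => by simp only [map_add, inner_add_right]; ring)
    (fun _ _ _ => by simp only [map_smul, inner_smul_right, RingHom.id_apply, smul_eq_mul]; ring)
    (fun _ _ _ => by simp only [map_add, inner_add_left]; ring)
    (fun _ _ _ => by simp only [map_smul, inner_smul_left, smul_eq_mul]; ring)

theorem shiftedForm_apply (l : ℝ) (ψ v : V) :
    shiftedForm J a l ψ v = a ψ v + (l : ℂ) * ⟪J v, J ψ⟫_ℂ := rfl

variable {J a}

theorem FormContinuous.shiftedForm (ha : FormContinuous a) (l : ℝ) :
    FormContinuous (shiftedForm J a l) := by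
  obtain ⟨M, -, hM⟩ := ha.exists_nonneg
  refine ⟨M + |l| * (‖J‖ * ‖J‖), fun ψ v => ?_⟩
  rw [shiftedForm_apply]
  have h1 : ‖⟪J v, J ψ⟫_ℂ‖ ≤ (‖J‖ * ‖v‖) * (‖J‖ * ‖ψ‖) :=
    (norm_inner_le_norm _ _).trans (by gcongr <;> exact J.le_opNorm _)
  calc ‖a ψ v + (l : ℂ) * ⟪J v, J ψ⟫_ℂ‖ ≤ M * ‖ψ‖ * ‖v‖ + |l| * ((‖J‖ * ‖v‖) * (‖J‖ * ‖ψ‖)) := by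
        refine (norm_add_le _ _).trans (add_le_add (hM ψ v) ?_)
        rw [norm_mul, Complex.norm_real, Real.norm_eq_abs]
        gcongr
    _ = (M + |l| * (‖J‖ * ‖J‖)) * ‖ψ‖ * ‖v‖ := by ring

theorem re_shiftedForm_self (l : ℝ) (ψ : V) :
    (shiftedForm J a l ψ ψ).re = (a ψ ψ).re + l * ‖J ψ‖ ^ 2 := by
  have h := re_inner_self_eq (J ψ)
  rw [shiftedForm_apply, Complex.add_re, Complex.re_ofReal_mul, h]

/-- Accretivity makes the operator of the form dissipative. The range condition is the Lax–Milgram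
theorem for the form `a + l (· | ·)_H`, which is coercive as soon as `l ≥ ω`. -/
theorem exists_isMaximalDissipative_formGraph [CompleteSpace H] [CompleteSpace V]
    (hJ : Function.Injective J) (hJd : DenseRange J) (hcont : FormContinuous a)
    (hell : FormElliptic J a) (hacc : FormAccretive a) :
    ∃ l₀ : ℝ, IsMaximalDissipative (formGraph J a) l₀ := by
  obtain ⟨α, hα, ω, hω⟩ := hell
  refine ⟨max ω 1, by positivity, ?_, ?_, ?_⟩
  · rintro ⟨x, y⟩ ⟨ψ, rfl, f, hf, rfl⟩
    have := hacc ψ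
    rw [hf] at this
    simp only [inner_neg_left, Complex.neg_re]
    rw [← inner_conj_symm, Complex.conj_re]
    linarith
  · intro l hl f
    obtain ⟨ψ, hψ⟩ := (hcont.shiftedForm (J := J) l).exists_forall_eq_inner hα (fun ψ => by
      rw [re_shiftedForm_self]
      refine (hω ψ).trans ?_
      have : ω ≤ l := (le_max_left _ _).trans hl
      gcongr) (ContinuousLinearMap.adjoint J f)
    refine ⟨J ψ, ψ, rfl, f - l • J ψ, fun v => ?_, by simp⟩
    have := hψ v
    rw [shiftedForm_apply, ContinuousLinearMap.adjoint_inner_right] at this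
    rw [inner_sub_right, inner_smul_right_eq_smul, Complex.real_smul, ← this]
    ring
  · rintro y ⟨ψ, h1, f, hf, rfl⟩
    have h0 : ψ = 0 := hJ (by rw [h1, map_zero])
    subst h0
    have : f = 0 := Dense.eq_zero_of_inner_right ℂ hJd (by
      rintro _ ⟨v, rfl⟩
      rw [← hf]; simp)
    rw [this, neg_zero]

theorem existsUnique_isFormSemigroup [CompleteSpace H] [CompleteSpace V]
    (hJ : Function.Injective J) (hJd : DenseRange J) (hcont : FormContinuous a)
    (hell : FormElliptic J a) (hacc : FormAccretive a) :
    ∃! T : ℝ≥0 → (H →L[ℂ] H), IsFormSemigroup J a T := by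
  obtain ⟨l₀, hG⟩ := exists_isMaximalDissipative_formGraph hJ hJd hcont hell hacc
  obtain ⟨R, hR⟩ := hG.exists_resolventFamily
  obtain ⟨T, hT, hTG, -⟩ := hR.exists_semigroup hG
  exact ⟨T, ⟨hT, hTG⟩, fun S hS => hS.1.eq_of_generatorGraph_eq hT hG hS.2 hTG⟩

end FormOperators

/-! ### Metric projections -/

section Projections

variable {H : Type*} [NormedAddCommGroup H] [InnerProductSpace ℂ H]

/-- `P` is the metric projection of `H` onto `C`, expressed by the variational inequality that
characterizes it. The existence of `P` forces `C` to be closed and convex. -/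
structure IsMetricProjection (P : H → H) (C : Set H) : Prop where
  mem : ∀ x, P x ∈ C
  re_inner_le : ∀ x, ∀ c ∈ C, (⟪x - P x, c - P x⟫_ℂ).re ≤ 0

namespace IsMetricProjection

variable {P : H → H} {C : Set H}

theorem apply_eq_self (hP : IsMetricProjection P C) {x : H} (hx : x ∈ C) : P x = x := by
  have := hP.re_inner_le x x hx
  rw [re_inner_self_eq] at this
  have h : x - P x = 0 := by
    rw [← norm_eq_zero]; nlinarith [norm_nonneg (x - P x)]
  exact (sub_eq_zero.1 h).symm

/-- A set with a metric projection is an intersection of closed half-spaces. -/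
theorem eq_iInter (hP : IsMetricProjection P C) :
    C = ⋂ x, {c | (⟪x - P x, c - P x⟫_ℂ).re ≤ 0} := by
  refine Set.Subset.antisymm (fun c hc => Set.mem_iInter.2 fun x => hP.re_inner_le x c hc) ?_
  intro c hc
  have := Set.mem_iInter.1 hc c
  simp only [Set.mem_ofPred_eq, re_inner_self_eq] at this
  have h : c - P c = 0 := by
    rw [← norm_eq_zero]; nlinarith [norm_nonneg (c - P c)]
  rw [sub_eq_zero.1 h]
  exact hP.mem c

theorem isClosed (hP : IsMetricProjection P C) : IsClosed C := by
  rw [hP.eq_iInter]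
  refine isClosed_iInter fun x => isClosed_le ?_ continuous_const
  fun_prop

theorem convex (hP : IsMetricProjection P C) : Convex ℝ C := by
  rw [hP.eq_iInter]
  refine convex_iInter fun x => ?_
  intro c hc d hd s t hs ht hst
  simp only [Set.mem_ofPred_eq] at hc hd ⊢
  have e : s • c + t • d - P x = s • (c - P x) + t • (d - P x) := by
    have : P x = (s + t) • P x := by rw [hst, one_smul]
    nth_rewrite 1 [this]
    module
  rw [e, inner_add_right, inner_smul_right_eq_smul, inner_smul_right_eq_smul, Complex.add_re,
    Complex.smul_re, Complex.smul_re, smul_eq_mul, smul_eq_mul]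
  nlinarith

theorem norm_sub_le (hP : IsMetricProjection P C) (x : H) {c : H} (hc : c ∈ C) :
    ‖x - P x‖ ≤ ‖x - c‖ := by
  have h1 := hP.re_inner_le x c hc
  have h2 : (⟪x - P x, x - c⟫_ℂ).re ≤ ‖x - P x‖ * ‖x - c‖ := re_inner_le_norm (𝕜 := ℂ) _ _
  have e : c - P x = (x - P x) - (x - c) := by abel
  rw [e, inner_sub_right, Complex.sub_re, re_inner_self_eq] at h1
  rcases (norm_nonneg (x - P x)).eq_or_lt with h0 | h0
  · rw [← h0]; positivity
  · nlinarith

theorem norm_apply_sub_le (hP : IsMetricProjection P C) (x y : H) : ‖P x - P y‖ ≤ ‖x - y‖ := by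
  have h1 := hP.re_inner_le x _ (hP.mem y)
  have h2 := hP.re_inner_le y _ (hP.mem x)
  have h3 : (⟪x - y, P x - P y⟫_ℂ).re ≤ ‖x - y‖ * ‖P x - P y‖ := re_inner_le_norm (𝕜 := ℂ) _ _
  have e1 : (⟪x - P x, P y - P x⟫_ℂ).re = -(⟪x - P x, P x - P y⟫_ℂ).re := by
    rw [← neg_sub (P x) (P y), inner_neg_right, Complex.neg_re]
  have e2 : x - y = (x - P x) - (y - P y) + (P x - P y) := by abel
  have e3 : (⟪x - y, P x - P y⟫_ℂ).re
      = (⟪x - P x, P x - P y⟫_ℂ).re - (⟪y - P y, P x - P y⟫_ℂ).re + ‖P x - P y‖ ^ 2 := by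
    rw [e2, inner_add_left, inner_sub_left, Complex.add_re, Complex.sub_re, re_inner_self_eq]
  rcases (norm_nonneg (P x - P y)).eq_or_lt with h0 | h0
  · rw [← h0]; positivity
  · nlinarith

theorem lipschitzWith (hP : IsMetricProjection P C) : LipschitzWith 1 P :=
  LipschitzWith.of_dist_le_mul fun x y => by
    simpa [dist_eq_norm] using hP.norm_apply_sub_le x y

end IsMetricProjection

end Projections

/-! ### Invariance of closed convex sets -/

section Invariance

variable {H : Type*} [NormedAddCommGroup H] [InnerProductSpace ℂ H]
variable {V : Type*} [NormedAddCommGroup V] [InnerProductSpace ℂ V]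
variable {P : H → H} {C : Set H}

open NormedSpace (exp)

theorem IsResolventFamily.smul_mem {G : Submodule ℂ (H × H)} {l₀ : ℝ} {R : ℝ → H →L[ℂ] H}
    (hR : IsResolventFamily G l₀ R) {l : ℝ} (hl : l₀ ≤ l) (f : H) :
    (l • R l f, l • (l • R l f - f)) ∈ G :=
  G.smul_of_tower_mem l (hR.mem l hl f)

/-- If a contraction semigroup leaves `C` invariant, so does `l R(l)`: here `x = l R(l) f`.
Comparing `T(h) x ≈ x + h l (x - f)` with `T(h) (P x) ∈ C` shows that the distance `d` of `x` to
`C` satisfies `(1 + h l) d ≤ d + o(h)`. -/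
theorem mem_of_leavesInvariant {T : ℝ≥0 → (H →L[ℂ] H)} (hP : IsMetricProjection P C)
    (hT : ∀ t x, ‖T t x‖ ≤ ‖x‖) (hC : LeavesInvariant T C) {l : ℝ} (hl : 0 < l) {x f : H}
    (hf : f ∈ C) (hx : (x, l • (x - f)) ∈ generatorGraph T) : x ∈ C := by
  have hlim : Tendsto (fun h : ℝ≥0 => ‖(h : ℝ)⁻¹ • (T h x - x) - l • (x - f)‖) (𝓝[>] 0) (𝓝 0) := by
    simpa using (Tendsto.sub_const (f := fun h : ℝ≥0 => (h : ℝ)⁻¹ • (T h x - x)) hx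
      (l • (x - f))).norm
  have key : l * ‖x - P x‖ ≤ 0 := by
    refine ge_of_tendsto hlim ?_
    filter_upwards [self_mem_nhdsWithin] with h hh
    have hh0 : (0 : ℝ) < h := hh
    have hpos : 0 < 1 + (h : ℝ) * l := by positivity
    have hc : (1 + (h : ℝ) * l)⁻¹ • T h (P x) + ((1 + (h : ℝ) * l)⁻¹ * (h * l)) • f ∈ C :=
      hP.convex (hC h _ (hP.mem x)) hf (by positivity) (by positivity) (by field_simp)
    have h1 := hP.norm_sub_le x hc
    have e : x - ((1 + (h : ℝ) * l)⁻¹ • T h (P x) + ((1 + (h : ℝ) * l)⁻¹ * (h * l)) • f)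
        = (1 + (h : ℝ) * l)⁻¹ •
          (T h (x - P x) - (h : ℝ) • ((h : ℝ)⁻¹ • (T h x - x) - l • (x - f))) := by
      rw [smul_sub (h : ℝ), smul_inv_smul₀ hh0.ne', map_sub]
      have : x = (1 + (h : ℝ) * l)⁻¹ • ((1 + (h : ℝ) * l) • x) := (inv_smul_smul₀ hpos.ne' x).symm
      nth_rewrite 1 [this]
      module
    rw [e, norm_smul, Real.norm_of_nonneg (inv_nonneg.2 hpos.le), ← div_eq_inv_mul,
      le_div_iff₀ hpos] at h1
    have h2 := norm_sub_le (T h (x - P x))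
      ((h : ℝ) • ((h : ℝ)⁻¹ • (T h x - x) - l • (x - f)))
    have h3 := hT h (x - P x)
    rw [norm_smul (h : ℝ), Real.norm_of_nonneg hh0.le] at h2
    have h4 : (h : ℝ) * (l * ‖x - P x‖) ≤
        h * ‖(h : ℝ)⁻¹ • (T h x - x) - l • (x - f)‖ := by linarith
    exact le_of_mul_le_mul_left h4 hh0
  have h0 : x - P x = 0 := by
    have := (mul_nonpos_iff_pos_imp_nonpos.1 key).1 hl
    simpa using this
  rw [sub_eq_zero.1 h0]
  exact hP.mem x

/-- `exp (s (K - 1)) = e^{-s} ∑ s^n K^n / n!` is a limit of convex combinations of powers of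
`K`. -/
theorem exp_smul_sub_one_apply_mem [CompleteSpace H] (hcl : IsClosed C) (hcv : Convex ℝ C)
    {K : H →L[ℂ] H} (hK : ∀ f ∈ C, K f ∈ C) {s : ℝ} (hs : 0 ≤ s) {f : H} (hf : f ∈ C) :
    exp (s • (K - 1)) f ∈ C := by
  have hpow : ∀ n : ℕ, (K ^ n) f ∈ C := by
    intro n
    induction n with
    | zero => simpa using hf
    | succ n ih => rw [pow_succ', mul_apply_eq_comp]; exact hK _ ih
  have h1 : HasSum (fun n : ℕ => (s ^ n / (n.factorial : ℝ)) • (K ^ n) f) (exp (s • K) f) := by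
    have := (NormedSpace.exp_series_hasSum_exp' (𝕂 := ℝ) (s • K)).mapL
      ((ContinuousLinearMap.apply ℂ H f).restrictScalars ℝ)
    refine this.congr_fun ?_
    intro n
    simp [smul_pow, smul_smul, div_eq_inv_mul]
  have h2 : HasSum (fun n : ℕ => s ^ n / (n.factorial : ℝ)) (Real.exp s) := by
    rw [Real.exp_eq_exp_ℝ]; exact NormedSpace.expSeries_div_hasSum_exp s
  have h3 := (h2.tendsto_sum_nat.inv₀ (Real.exp_ne_zero s)).smul h1.tendsto_sum_nat
  have e : exp (s • (K - 1)) f = (Real.exp s)⁻¹ • exp (s • K) f := by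
    let : NormedAlgebra ℚ (H →L[ℂ] H) := NormedAlgebra.restrictScalars ℚ ℝ _
    have hcomm : Commute (s • K) (-(s • (1 : H →L[ℂ] H))) :=
      (((Commute.one_right K).smul_left s).smul_right s).neg_right
    have hone : exp (-(s • (1 : H →L[ℂ] H))) = (Real.exp s)⁻¹ • (1 : H →L[ℂ] H) := by
      rw [← neg_smul, ← Algebra.algebraMap_eq_smul_one, ← NormedSpace.algebraMap_exp_comm,
        Algebra.algebraMap_eq_smul_one, ← Real.exp_eq_exp_ℝ, Real.exp_neg]
    rw [smul_sub, sub_eq_add_neg, NormedSpace.exp_add_of_commute hcomm, hone, mul_smul_comm,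
      mul_one]
    rfl
  rw [e]
  refine hcl.mem_of_tendsto h3 ?_
  filter_upwards [eventually_gt_atTop 0] with n hn
  refine hcv.centerMass_mem (fun i _ => by positivity) ?_ (fun i _ => hpow i)
  refine Finset.sum_pos' (fun i _ => by positivity) ⟨0, by simpa using hn, by simp⟩

/-- Bounded sequences in a Hilbert space have weak limits along a free ultrafilter. -/
theorem exists_weak_limit [CompleteSpace V] {ψ : ℕ → V} {B : ℝ} (hB : ∀ n, ‖ψ n‖ ≤ B) :
    ∃ u : V, ∀ L : V →L[ℂ] ℂ, Tendsto (fun n => L (ψ n)) (hyperfilter ℕ) (𝓝 (L u)) := by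
  let g : ℕ → WeakDual ℂ V :=
    fun n => StrongDual.toWeakDual (InnerProductSpace.toDual ℂ V (ψ n))
  have hc := WeakDual.isCompact_closedBall (𝕜 := ℂ) (E := V) 0 B
  obtain ⟨w, -, hw⟩ := hc.ultrafilter_le_nhds ((hyperfilter ℕ).map g) (by
    rw [le_principal_iff, Ultrafilter.mem_coe, Ultrafilter.mem_map]
    refine univ_mem' fun n => ?_
    have : ‖InnerProductSpace.toDual ℂ V (ψ n)‖ ≤ B := by simpa using hB n
    simpa [g] using this)
  have hw' : Tendsto g (hyperfilter ℕ) (𝓝 w) := hw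
  refine ⟨(InnerProductSpace.toDual ℂ V).symm (WeakDual.toStrongDual w), fun L => ?_⟩
  obtain ⟨v, rfl⟩ := (InnerProductSpace.toDual ℂ V).surjective L
  have h1 : Tendsto (fun n => ⟪ψ n, v⟫_ℂ) (hyperfilter ℕ) (𝓝 (w v)) :=
    ((WeakDual.eval_continuous v).tendsto w).comp hw'
  have h2 := (Complex.continuous_conj.tendsto _).comp h1
  have e : w v = ⟪(InnerProductSpace.toDual ℂ V).symm (WeakDual.toStrongDual w), v⟫_ℂ := by
    rw [InnerProductSpace.toDual_symm_apply]; rfl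
  simp only [InnerProductSpace.toDual_apply_apply]
  rw [← inner_conj_symm, ← e]
  refine h2.congr fun n => ?_
  simp [Function.comp]

/-- **Ouhabaz' invariance criterion**: the semigroup of an accretive form leaves a closed convex
set invariant if and only if the projection `P` onto the set maps the form domain to itself and
`Re a(Pψ, ψ - Pψ) ≥ 0`. -/
theorem IsFormSemigroup.leavesInvariant_iff [CompleteSpace H] [CompleteSpace V]
    {J : V →L[ℂ] H} {a : V →ₗ[ℂ] V →ₗ⋆[ℂ] ℂ} {T : ℝ≥0 → (H →L[ℂ] H)}
    (hT : IsFormSemigroup J a T)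
    (hJ : Function.Injective J) (hJd : DenseRange J) (hcont : FormContinuous a)
    (hell : FormElliptic J a) (hacc : FormAccretive a) (hP : IsMetricProjection P C) :
    LeavesInvariant T C ↔ ∀ ψ, ∃ u, J u = P (J ψ) ∧ 0 ≤ (a u (ψ - u)).re := by
  obtain ⟨l₀, hG⟩ := exists_isMaximalDissipative_formGraph hJ hJd hcont hell hacc
  obtain ⟨R, hR⟩ := hG.exists_resolventFamily
  constructor
  · intro hC ψ
    have hcontr := hT.1.norm_apply_le hG hT.2
    set p := P (J ψ) with hp
    have hpC : p ∈ C := hP.mem _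
    obtain ⟨N, hN⟩ := exists_nat_ge l₀
    have hNk : ∀ k : ℕ, l₀ ≤ ((k + N : ℕ) : ℝ) := fun k =>
      hN.trans (by exact_mod_cast (by omega))
    have hpos : ∀ k : ℕ, 0 < ((k + N : ℕ) : ℝ) := fun k => hG.pos.trans_le (hNk k)
    -- `χ k` represents `n R(n) p`, with `n = k + N`
    have hχ : ∀ k : ℕ, ∃ χ : V, J χ = ((k + N : ℕ) : ℝ) • R ((k + N : ℕ) : ℝ) p ∧
        ∀ v, a χ v = ⟪J v, ((k + N : ℕ) : ℝ) • (p - J χ)⟫_ℂ := by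
      intro k
      have := hR.smul_mem (hNk k) p
      obtain ⟨χ, h1, f, h2, h3⟩ := this
      refine ⟨χ, h1, fun v => ?_⟩
      rw [h2, h1, ← neg_sub (((k + N : ℕ) : ℝ) • R ((k + N : ℕ) : ℝ) p) p, smul_neg]
      simp only at h3
      rw [h3, neg_neg]
    choose χ hχJ hχa using hχ
    have hχC : ∀ k, J (χ k) ∈ C := by
      intro k
      rw [hχJ]
      refine mem_of_leavesInvariant hP hcontr hC (hpos k) hpC ?_
      rw [hT.2]
      exact hR.smul_mem (hNk k) p
    have hre : ∀ k, 0 ≤ (a (χ k) (ψ - χ k)).re := by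
      intro k
      have h1 := hP.re_inner_le (J ψ) _ (hχC k)
      rw [← hp] at h1
      have e : J (ψ - χ k) = (J ψ - p) + (p - J (χ k)) := by rw [map_sub]; abel
      have e2 : ⟪J ψ - p, p - J (χ k)⟫_ℂ = -⟪J ψ - p, J (χ k) - p⟫_ℂ := by
        rw [← neg_sub (J (χ k)) p, inner_neg_right]
      rw [hχa, inner_smul_right_eq_smul, Complex.smul_re, e, inner_add_left, Complex.add_re,
        re_inner_self_eq, e2, Complex.neg_re, smul_eq_mul]
      have := hpos k
      refine mul_nonneg this.le (by nlinarith [sq_nonneg ‖p - J (χ k)‖])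
    have hle : ∀ k, (a (χ k) (χ k)).re ≤ (a (χ k) ψ).re := by
      intro k
      have := hre k
      rw [map_sub, Complex.sub_re] at this
      linarith
    -- ellipticity bounds `‖χ k‖` since `Re a(χ, χ) ≤ Re a(χ, ψ)` grows at most linearly in `‖χ‖`
    have hbdd : ∃ B, ∀ k, ‖χ k‖ ≤ B := by
      obtain ⟨α, hα, ω, hω⟩ := hell
      obtain ⟨M, hM0, hM⟩ := hcont.exists_nonneg
      refine ⟨(M * ‖ψ‖ + |ω| * ‖p‖ ^ 2) / α + 1, fun k => ?_⟩
      have h1 := hω (χ k)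
      have h2 := (Complex.re_le_norm _).trans (hM (χ k) ψ)
      have h3 : ‖J (χ k)‖ ≤ ‖p‖ := by rw [hχJ]; exact hR.norm_le _ (hNk k) p
      have h4 : ω * ‖J (χ k)‖ ^ 2 ≤ |ω| * ‖p‖ ^ 2 := by
        refine (mul_le_mul_of_nonneg_right (le_abs_self ω) (sq_nonneg _)).trans ?_
        gcongr
      have h5 := hle k
      by_contra! h6
      have h7 : 1 ≤ ‖χ k‖ := by
        have : 0 ≤ (M * ‖ψ‖ + |ω| * ‖p‖ ^ 2) / α := by positivity
        linarith
      have h8 : M * ‖ψ‖ + |ω| * ‖p‖ ^ 2 < α * ‖χ k‖ := by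
        rw [mul_comm α, ← div_lt_iff₀ hα]; linarith
      have h9 : (M * ‖ψ‖ + |ω| * ‖p‖ ^ 2) * ‖χ k‖ < α * ‖χ k‖ * ‖χ k‖ :=
        mul_lt_mul_of_pos_right h8 (by linarith)
      have h10 : |ω| * ‖p‖ ^ 2 * 1 ≤ |ω| * ‖p‖ ^ 2 * ‖χ k‖ := by gcongr
      nlinarith
    obtain ⟨B, hB⟩ := hbdd
    obtain ⟨u, hu⟩ := exists_weak_limit hB
    have hJu : J u = p := by
      refine ext_inner_left ℂ fun h => ?_
      have h1 := hu ((innerSL ℂ h).comp J)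
      have h2 : Tendsto (fun k => J (χ k)) atTop (𝓝 p) :=
        ((tendsto_add_atTop_iff_nat N).2 (hR.tendsto_smul_apply hG p)).congr fun k => (hχJ k).symm
      have h3 : Tendsto (fun k => ⟪h, J (χ k)⟫_ℂ) (hyperfilter ℕ) (𝓝 ⟪h, p⟫_ℂ) :=
        (tendsto_const_nhds.inner h2).mono_left Nat.hyperfilter_le_atTop
      exact tendsto_nhds_unique h1 h3
    refine ⟨u, hJu, ?_⟩
    -- weak lower semicontinuity of `Re a(χ, χ)`, from accretivity
    obtain ⟨L₁, hL₁⟩ := hcont.exists_dual_left ψ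
    obtain ⟨L₂, hL₂⟩ := hcont.exists_dual_left u
    obtain ⟨L₃, hL₃⟩ := hcont.exists_dual_right u
    have hlim := (Complex.continuous_re.tendsto _).comp (((hu L₁).sub (hu L₂)).sub (hu L₃))
    have hge : 0 ≤ (L₁ u - L₂ u - L₃ u).re + (a u u).re := by
      have := ge_of_tendsto' (b := -(a u u).re) hlim (fun k => by
        have h1 := hacc (χ k - u)
        have h2 := hle k
        simp only [map_sub, LinearMap.sub_apply, Complex.sub_re] at h1
        simp only [Function.comp, hL₁, hL₂, hL₃, Complex.sub_re, Complex.conj_re]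
        linarith)
      linarith
    simp only [hL₁, hL₂, hL₃, Complex.sub_re, Complex.conj_re] at hge
    rw [map_sub, Complex.sub_re]
    linarith
  · intro hcrit
    have hRC : ∀ l, l₀ ≤ l → ∀ f ∈ C, l • R l f ∈ C := by
      intro l hl f hf
      have hl0 : 0 < l := hG.pos.trans_le hl
      obtain ⟨ψ, h1, g, h2, h3⟩ := hR.smul_mem hl f
      simp only at h1 h3
      set x := l • R l f with hx
      obtain ⟨u, hu, hu0⟩ := hcrit ψ
      have hg : g = l • (f - x) := by
        rw [← neg_eq_iff_eq_neg.2 h3, ← neg_sub x f, smul_neg]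
      have h4 := hacc (ψ - u)
      have h5 : 0 ≤ (a ψ (ψ - u)).re := by
        have : a ψ (ψ - u) = a (ψ - u) (ψ - u) + a u (ψ - u) := by
          rw [← LinearMap.add_apply, ← map_add, sub_add_cancel]
        rw [this, Complex.add_re]
        linarith
      rw [h2, hg, inner_smul_right_eq_smul, Complex.smul_re, map_sub, hu, h1, smul_eq_mul] at h5
      have h6 := hP.re_inner_le x f hf
      have e : f - x = (f - P x) - (x - P x) := by abel
      rw [e, inner_sub_right, Complex.sub_re, re_inner_self_eq] at h5
      have h7 := nonneg_of_mul_nonneg_right h5 hl0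
      have h8 : x - P x = 0 := by
        rw [← norm_eq_zero]; nlinarith [norm_nonneg (x - P x)]
      rw [sub_eq_zero.1 h8]
      exact hP.mem x
    -- pass to the limit in the Yosida approximations
    obtain ⟨S, hS, hSG, hSlim⟩ := hR.exists_semigroup hG
    have hST : T = S := hT.1.eq_of_generatorGraph_eq hS hG hT.2 hSG
    intro t f hf
    rw [hST]
    refine hP.isClosed.mem_of_tendsto (hSlim t f) ?_
    filter_upwards [tendsto_natCast_atTop_atTop.eventually_ge_atTop l₀] with n hn
    rw [yosida, smul_smul]
    exact exp_smul_sub_one_apply_mem hP.isClosed hP.convex (K := (n : ℝ) • R n)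
      (fun f hf => hRC n hn f hf) (by positivity) hf

end Invariance

/-! ### Projections in `L²` and in direct sums -/

section PointwiseProjections

variable {X : Type*} [MeasurableSpace X] {μ : Measure X} {π : ℂ → ℂ} {K : Set ℂ}

/-- Composition with the metric projection of `ℂ` onto a set `K ∋ 0`, as a map of `L²`. -/
def pointwiseProj (μ : Measure X) (hπ : IsMetricProjection π K) (h0 : (0 : ℂ) ∈ K) :
    Lp ℂ 2 μ → Lp ℂ 2 μ :=
  hπ.lipschitzWith.compLp (hπ.apply_eq_self h0)

theorem coeFn_pointwiseProj (hπ : IsMetricProjection π K) (h0 : (0 : ℂ) ∈ K) (f : Lp ℂ 2 μ) :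
    pointwiseProj μ hπ h0 f =ᵐ[μ] fun x => π (f x) :=
  hπ.lipschitzWith.coeFn_compLp (hπ.apply_eq_self h0) f

theorem isMetricProjection_pointwiseProj (hπ : IsMetricProjection π K) (h0 : (0 : ℂ) ∈ K) :
    IsMetricProjection (pointwiseProj μ hπ h0) {f : Lp ℂ 2 μ | ∀ᵐ x ∂μ, f x ∈ K} where
  mem f := by
    filter_upwards [coeFn_pointwiseProj hπ h0 f] with x hx
    rw [hx]
    exact hπ.mem _
  re_inner_le f g hg := by
    rw [L2.inner_def]
    have h1 := integral_re (𝕜 := ℂ) (L2.integrable_inner (𝕜 := ℂ) (f - pointwiseProj μ hπ h0 f)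
      (g - pointwiseProj μ hπ h0 f))
    simp only [RCLike.re_to_complex] at h1
    rw [← h1]
    refine integral_nonpos_of_ae ?_
    filter_upwards [coeFn_pointwiseProj hπ h0 f, Lp.coeFn_sub f (pointwiseProj μ hπ h0 f),
      Lp.coeFn_sub g (pointwiseProj μ hπ h0 f), hg] with x h2 h3 h4 h5
    rw [h3, h4, Pi.sub_apply, Pi.sub_apply, h2]
    exact hπ.re_inner_le _ _ h5

theorem eq_pointwiseProj_iff (hπ : IsMetricProjection π K) (h0 : (0 : ℂ) ∈ K) {f g : Lp ℂ 2 μ} :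
    g = pointwiseProj μ hπ h0 f ↔ g =ᵐ[μ] fun x => π (f x) := by
  constructor
  · rintro rfl
    exact coeFn_pointwiseProj hπ h0 f
  · exact fun h => Lp.ext (h.trans (coeFn_pointwiseProj hπ h0 f).symm)

end PointwiseProjections

section DirectSums

variable {ι : Type*} {V : ι → Type*} {E : ι → Type*}
  [∀ i, NormedAddCommGroup (V i)] [∀ i, InnerProductSpace ℂ (V i)]
  [∀ i, NormedAddCommGroup (E i)] [∀ i, InnerProductSpace ℂ (E i)]

/-- The metric projection of a Hilbert direct sum onto a product of convex sets containing `0` acts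
componentwise. -/
theorem exists_isMetricProjection_pi {P : ∀ i, E i → E i} {C : ∀ i, Set (E i)}
    (hP : ∀ i, IsMetricProjection (P i) (C i)) (h0 : ∀ i, (0 : E i) ∈ C i) :
    ∃ Q : lp E 2 → lp E 2, (∀ f i, Q f i = P i (f i)) ∧
      IsMetricProjection Q {f | ∀ i, f i ∈ C i} := by
  have hmem : ∀ f : lp E 2, Memℓp (fun i => P i (f i)) 2 := fun f =>
    (lp.memℓp f).mono' fun i => by
      have := (hP i).norm_apply_sub_le (f i) 0
      rwa [(hP i).apply_eq_self (h0 i), sub_zero, sub_zero] at this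
  refine ⟨fun f => ⟨fun i => P i (f i), hmem f⟩, fun f i => rfl, fun f i => (hP i).mem _, ?_⟩
  intro f c hc
  have h1 := lp.hasSum_inner (𝕜 := ℂ) (f - ⟨fun i => P i (f i), hmem f⟩)
    (c - ⟨fun i => P i (f i), hmem f⟩)
  exact (Complex.hasSum_re h1).nonpos fun i => (hP i).re_inner_le (f i) (c i) (hc i)

variable {φ : ∀ i, V i →L[ℂ] E i} {hφ : UniformlyBounded φ}

theorem directSumMap_injective (hφinj : ∀ i, Function.Injective (φ i)) :
    Function.Injective (directSumMap φ hφ) := fun ψ ψ' h => by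
  ext i
  exact hφinj i (congrArg (fun f : lp E 2 => f i) h)

variable [DecidableEq ι]

theorem directSumMap_single (i : ι) (v : V i) :
    directSumMap φ hφ (lp.single 2 i v) = lp.single 2 i (φ i v) := by
  ext j
  rw [directSumMap_apply]
  by_cases h : j = i
  · subst h; simp
  · rw [lp.single_apply_ne _ _ _ h, lp.single_apply_ne _ _ _ h, map_zero]

theorem directSumMap_denseRange [∀ i, CompleteSpace (E i)] (hφd : ∀ i, DenseRange (φ i)) :
    DenseRange (directSumMap φ hφ) := by
  change Dense (Set.range (directSumMap φ hφ))
  have e : Set.range (directSumMap φ hφ) = ((directSumMap φ hφ).range : Set (lp E 2)) := rfl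
  rw [e, Submodule.dense_iff_topologicalClosure_eq_top,
    Submodule.topologicalClosure_eq_top_iff, Submodule.eq_bot_iff]
  intro y hy
  ext i
  refine Dense.eq_zero_of_inner_right ℂ (hφd i) ?_
  rintro _ ⟨v, rfl⟩
  have h1 : ⟪directSumMap φ hφ (lp.single 2 i v), y⟫_ℂ = 0 := hy _ ⟨_, rfl⟩
  rwa [directSumMap_single, lp.inner_single_left] at h1

variable {a : lp V 2 →ₗ[ℂ] lp V 2 →ₗ⋆[ℂ] ℂ}

theorem FormContinuous.diag (ha : FormContinuous a) (i : ι) :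
    FormContinuous (formEntry a i i) := by
  obtain ⟨M, hM⟩ := ha
  refine ⟨M, fun ψ ψ' => ?_⟩
  have := hM (lp.single 2 i ψ) (lp.single 2 i ψ')
  rwa [lp.norm_single (by norm_num), lp.norm_single (by norm_num)] at this

theorem FormAccretive.diag (ha : FormAccretive a) (i : ι) : FormAccretive (formEntry a i i) :=
  fun _ => ha _

/-- The diagonal entries inherit ellipticity with the constants of the whole form. -/
theorem re_formEntry_self_ge {α ω : ℝ}
    (h : ∀ ψ : lp V 2, α * ‖ψ‖ ^ 2 ≤ (a ψ ψ).re + ω * ‖directSumMap φ hφ ψ‖ ^ 2) (i : ι)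
    (ψ : V i) : α * ‖ψ‖ ^ 2 ≤ (formEntry a i i ψ ψ).re + ω * ‖φ i ψ‖ ^ 2 := by
  have := h (lp.single 2 i ψ)
  rwa [directSumMap_single, lp.norm_single (by norm_num), lp.norm_single (by norm_num)] at this

theorem FormElliptic.diag (ha : FormElliptic (directSumMap φ hφ) a) (i : ι) :
    FormElliptic (φ i) (formEntry a i i) :=
  let ⟨α, hα, ω, h⟩ := ha
  ⟨α, hα, ω, re_formEntry_self_ge h i⟩

theorem FormContinuous.hasSum_left (ha : FormContinuous a) (ψ v : lp V 2) :
    HasSum (fun j => a (lp.single 2 j (ψ j)) v) (a ψ v) := by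
  obtain ⟨L, hL⟩ := ha.exists_dual_left v
  simpa only [hL] using (lp.hasSum_single (by norm_num) ψ).mapL L

theorem FormContinuous.hasSum_right (ha : FormContinuous a) (v ψ : lp V 2) :
    HasSum (fun i => a v (lp.single 2 i (ψ i))) (a v ψ) := by
  obtain ⟨L, hL⟩ := ha.exists_dual_right v
  have h := (lp.hasSum_single (by norm_num) ψ).mapL L
  simp only [hL] at h
  simpa using Complex.hasSum_conj'.1 h

/-- The entries `a_{ij}(ψ_j, ψ')` sum up to `a(ψ, ψ')` if `ψ'` is concentrated at the place `i`. -/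
theorem FormContinuous.hasSum_formEntry (ha : FormContinuous a) (ψ : lp V 2) (i : ι) (v : V i) :
    HasSum (fun j => formEntry a i j (ψ j) v) (a ψ (lp.single 2 i v)) :=
  ha.hasSum_left ψ _

theorem FormContinuous.re_nonneg_of_entries (ha : FormContinuous a) {ψ v : lp V 2}
    (h : ∀ i j, 0 ≤ (formEntry a i j (ψ j) (v i)).re) : 0 ≤ (a ψ v).re :=
  (Complex.hasSum_re (ha.hasSum_right ψ v)).nonneg fun i =>
    (Complex.hasSum_re (ha.hasSum_formEntry ψ i (v i))).nonneg fun j => h i j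

variable {P : ∀ i, E i → E i} {C : ∀ i, Set (E i)}

/-- If the invariance criterion holds for all diagonal entries, then the componentwise projection
maps the direct sum of the form domains to itself: ellipticity of the entries `a_{ii}`, with
constants independent of `i`, bounds `ψ_i - u_i` by a fixed multiple of `ψ_i`. -/
theorem exists_lp_of_diag (hcont : FormContinuous a)
    (hell : FormElliptic (directSumMap φ hφ) a)
    (hP : ∀ i, IsMetricProjection (P i) (C i)) (h0 : ∀ i, (0 : E i) ∈ C i)
    (h : ∀ i (ψ : V i), ∃ u, φ i u = P i (φ i ψ) ∧ 0 ≤ (formEntry a i i u (ψ - u)).re)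
    (ψ : lp V 2) : ∃ u : lp V 2, ∀ i, φ i (u i) = P i (φ i (ψ i)) := by
  choose u hu hu0 using fun i => h i (ψ i)
  obtain ⟨α, hα, ω, hω⟩ := hell
  obtain ⟨M, hM0, hM⟩ := hcont.exists_nonneg
  obtain ⟨M', hM'0, hM'⟩ := hφ.exists_nonneg
  have hb : ∀ i, ‖ψ i - u i‖ ≤ (M + |ω| * M' ^ 2) / α * ‖ψ i‖ := by
    intro i
    set w := ψ i - u i with hw
    have h1 := re_formEntry_self_ge hω i w
    have h2 : formEntry a i i w w = formEntry a i i (ψ i) w - formEntry a i i (u i) w := by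
      rw [hw, ← LinearMap.sub_apply, ← map_sub]
    have h3 := hM (lp.single 2 i (ψ i)) (lp.single 2 i w)
    rw [lp.norm_single (by norm_num), lp.norm_single (by norm_num), ← formEntry_apply] at h3
    have h4 := (Complex.re_le_norm _).trans h3
    have h5 : ‖φ i w‖ ≤ M' * ‖ψ i‖ := by
      rw [hw, map_sub, hu]
      have := (hP i).norm_sub_le (φ i (ψ i)) (h0 i)
      rw [sub_zero] at this
      exact this.trans (hM' i _)
    have h6 : ω * ‖φ i w‖ ^ 2 ≤ |ω| * ((M' * ‖ψ i‖) * (M' * ‖w‖)) := by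
      refine (mul_le_mul_of_nonneg_right (le_abs_self ω) (sq_nonneg _)).trans ?_
      rw [sq]
      gcongr
      exact hM' i w
    have h7 := hu0 i
    rw [← hw] at h7
    rw [h2, Complex.sub_re] at h1
    have h8 : (α * ‖w‖) * ‖w‖ ≤ ((M + |ω| * M' ^ 2) * ‖ψ i‖) * ‖w‖ := by nlinarith
    rw [div_mul_eq_mul_div, le_div_iff₀' hα]
    rcases (norm_nonneg w).eq_or_lt with h9 | h9
    · rw [← h9, mul_zero]; positivity
    · exact le_of_mul_le_mul_right h8 h9
  have hw : Memℓp (fun i => ψ i - u i) 2 := by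
    refine ((lp.memℓp ψ).const_smul (((M + |ω| * M' ^ 2) / α : ℝ) : ℂ)).mono' fun i => ?_
    refine (hb i).trans_eq ?_
    rw [Pi.smul_apply, norm_smul, Complex.norm_real, Real.norm_of_nonneg (by positivity)]
  refine ⟨ψ - ⟨_, hw⟩, fun i => ?_⟩
  rw [← hu i]
  congr 1
  exact sub_sub_cancel (ψ i) (u i)

/-- The invariance criterion for a product of convex sets. By `exists_lp_of_diag`, the condition on
the form domain only concerns the individual spaces `V i`. -/
theorem IsFormSemigroup.leavesInvariant_pi_iff [∀ i, CompleteSpace (V i)]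
    [∀ i, CompleteSpace (E i)] {T : ℝ≥0 → (lp E 2 →L[ℂ] lp E 2)}
    (hT : IsFormSemigroup (directSumMap φ hφ) a T)
    (hφinj : ∀ i, Function.Injective (φ i)) (hφd : ∀ i, DenseRange (φ i))
    (hcont : FormContinuous a) (hell : FormElliptic (directSumMap φ hφ) a)
    (hacc : FormAccretive a)
    (hP : ∀ i, IsMetricProjection (P i) (C i)) (h0 : ∀ i, (0 : E i) ∈ C i) :
    LeavesInvariant T {f | ∀ i, f i ∈ C i} ↔
      (∀ i (ψ : V i), ∃ u, φ i u = P i (φ i ψ) ∧ 0 ≤ (formEntry a i i u (ψ - u)).re) ∧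
      ∀ ψ u : lp V 2, (∀ i, φ i (u i) = P i (φ i (ψ i))) → 0 ≤ (a u (ψ - u)).re := by
  obtain ⟨Q, hQ, hQC⟩ := exists_isMetricProjection_pi hP h0
  rw [hT.leavesInvariant_iff (directSumMap_injective hφinj) (directSumMap_denseRange hφd) hcont
    hell hacc hQC]
  constructor
  · intro h
    have h2 : ∀ ψ u : lp V 2, (∀ i, φ i (u i) = P i (φ i (ψ i))) → 0 ≤ (a u (ψ - u)).re := by
      intro ψ u hu
      obtain ⟨u', hu', h1⟩ := h ψ
      have : u' = u := by
        ext i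
        refine hφinj i ?_
        rw [hu i, ← directSumMap_apply φ hφ u' i, hu', hQ, directSumMap_apply]
      rwa [this] at h1
    refine ⟨fun i ψ => ?_, h2⟩
    obtain ⟨u, hu, h1⟩ := h (lp.single 2 i ψ)
    have hui : ∀ j, φ j (u j) = P j (φ j (lp.single (E := V) 2 i ψ j)) := fun j => by
      rw [← directSumMap_apply φ hφ u j, hu, hQ, directSumMap_apply]
    have e : u = lp.single 2 i (u i) := by
      ext j
      by_cases hj : j = i
      · subst hj; simp
      · have := hui j
        rw [lp.single_apply_ne _ _ _ hj, map_zero, (hP j).apply_eq_self (h0 j)] at this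
        rw [lp.single_apply_ne _ _ _ hj]
        exact hφinj j (by rw [this, map_zero])
    refine ⟨u i, by simpa using hui i, ?_⟩
    rw [e, ← lp.single_sub] at h1
    rw [formEntry_apply]
    simpa using h1
  · rintro ⟨h1, h2⟩ ψ
    obtain ⟨u, hu⟩ := exists_lp_of_diag hcont hell hP h0 h1 ψ
    refine ⟨u, ?_, h2 ψ u hu⟩
    ext i
    rw [directSumMap_apply, hQ, directSumMap_apply, hu]

end DirectSums

/-! ### Projections of the complex plane -/

section PlanarProjections

theorem isMetricProjection_re : IsMetricProjection (fun z : ℂ => (z.re : ℂ)) {z | z.im = 0} where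
  mem z := by simp
  re_inner_le z c hc := by
    have hc' : c.im = 0 := hc
    simp [RCLike.inner_apply, hc']

theorem isMetricProjection_max_re :
    IsMetricProjection (fun z : ℂ => ((max z.re 0 : ℝ) : ℂ)) {z | z.im = 0 ∧ 0 ≤ z.re} where
  mem z := by simp
  re_inner_le z c hc := by
    obtain ⟨h1, h2⟩ : c.im = 0 ∧ 0 ≤ c.re := hc
    simp only [RCLike.inner_apply, Complex.mul_re, Complex.sub_re, Complex.ofReal_re,
      Complex.conj_re, Complex.sub_im, h1, Complex.ofReal_im, sub_zero, zero_mul]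
    rcases le_total z.re 0 with h | h
    · rw [max_eq_right h]; nlinarith
    · rw [max_eq_left h]; simp

theorem norm_csign {z : ℂ} (hz : z ≠ 0) : ‖csign z‖ = 1 := by
  rw [csign, norm_div, Complex.norm_real, norm_norm, div_self (norm_ne_zero_iff.2 hz)]

theorem norm_csign_le (z : ℂ) : ‖csign z‖ ≤ 1 := by
  by_cases hz : z = 0
  · simp [csign, hz]
  · exact (norm_csign hz).le

theorem norm_mul_csign (z : ℂ) : (‖z‖ : ℂ) * csign z = z := by
  by_cases hz : z = 0
  · simp [hz]
  · rw [csign, mul_div_cancel₀]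
    exact_mod_cast norm_ne_zero_iff.2 hz

theorem conj_csign_mul (z : ℂ) : (starRingEnd ℂ) (csign z) * z = ‖z‖ := by
  by_cases hz : z = 0
  · simp [hz]
  · have h1 : (‖z‖ : ℂ) ≠ 0 := by exact_mod_cast norm_ne_zero_iff.2 hz
    rw [csign, map_div₀, Complex.conj_ofReal, div_mul_eq_mul_div, Complex.conj_mul', sq,
      mul_div_cancel_right₀ _ h1]

theorem unitTrunc_add_unitExcess (z : ℂ) : unitTrunc z + unitExcess z = z := by
  have e : min 1 ‖z‖ + max (‖z‖ - 1) 0 = ‖z‖ := by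
    rcases le_total 1 ‖z‖ with h | h
    · rw [min_eq_left h, max_eq_left (by linarith)]; ring
    · rw [min_eq_right h, max_eq_right (by linarith)]; ring
  rw [unitTrunc, unitExcess, ← add_mul, ← Complex.ofReal_add, e, norm_mul_csign]

theorem isMetricProjection_unitTrunc : IsMetricProjection unitTrunc {z | ‖z‖ ≤ 1} where
  mem z := by
    change ‖unitTrunc z‖ ≤ 1
    rw [unitTrunc, norm_mul, Complex.norm_real, Real.norm_of_nonneg (by positivity)]
    exact mul_le_one₀ (min_le_left _ _) (norm_nonneg _) (norm_csign_le z)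
  re_inner_le z c hc := by
    have hc' : ‖c‖ ≤ 1 := hc
    have e : z - unitTrunc z = unitExcess z := by
      nth_rewrite 1 [← unitTrunc_add_unitExcess z]; ring
    rw [e]
    rcases le_total ‖z‖ 1 with h | h
    · rw [unitExcess, max_eq_right (by linarith)]; simp
    · have hz : z ≠ 0 := by rintro rfl; simp at h; linarith
      rw [unitExcess, unitTrunc, max_eq_left (by linarith), min_eq_left h, Complex.ofReal_one,
        one_mul, ← Complex.real_smul, inner_smul_left_eq_smul, Complex.smul_re, inner_sub_right,
        Complex.sub_re, re_inner_self_eq, norm_csign hz, smul_eq_mul]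
      have h1 : (⟪csign z, c⟫_ℂ).re ≤ ‖csign z‖ * ‖c‖ :=
        (Complex.re_le_norm _).trans (norm_inner_le_norm _ _)
      rw [norm_csign hz] at h1
      exact mul_nonpos_of_nonneg_of_nonpos (by linarith) (by linarith)

end PlanarProjections

/-! ### The invariance criterion for pointwise constraints -/

section RealPositive

variable {X : Type*} [MeasurableSpace X] {μ : Measure X}

theorem zero_mem_ae (μ : Measure X) {K : Set ℂ}
    (h0 : (0 : ℂ) ∈ K) : (0 : Lp ℂ 2 μ) ∈ {f : Lp ℂ 2 μ | ∀ᵐ x ∂μ, f x ∈ K} := by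
  filter_upwards [Lp.coeFn_zero ℂ 2 μ] with x hx
  rw [hx]
  exact h0

theorem zero_mem_realL2 : (0 : Lp ℂ 2 μ) ∈ realL2 μ := zero_mem_ae μ (K := {z | z.im = 0}) rfl

theorem zero_mem_posL2 : (0 : Lp ℂ 2 μ) ∈ posL2 μ :=
  zero_mem_ae μ (K := {z | z.im = 0 ∧ 0 ≤ z.re}) ⟨rfl, le_rfl⟩

theorem posL2_subset_realL2 (μ : Measure X) :
    posL2 μ ⊆ realL2 μ := by
  intro f hf
  change ∀ᵐ x ∂μ, _ at hf ⊢
  exact hf.mono fun x hx => hx.1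

theorem mem_posL2_of_ae_eq {f : Lp ℂ 2 μ}
    {r : X → ℝ} (h : f =ᵐ[μ] fun x => ((max (r x) 0 : ℝ) : ℂ)) : f ∈ posL2 μ := by
  change ∀ᵐ x ∂μ, _
  filter_upwards [h] with x hx
  rw [hx]
  simp

theorem mem_realL2_of_ae_eq {f : Lp ℂ 2 μ}
    {r : X → ℝ} (h : f =ᵐ[μ] fun x => (r x : ℂ)) : f ∈ realL2 μ := by
  filter_upwards [h] with x hx
  rw [hx, Complex.ofReal_im]

/-- The difference of a function and its real part is imaginary. -/
theorem neg_I_smul_sub_mem_realL2 {W : Type*} [NormedAddCommGroup W]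
    [InnerProductSpace ℂ W] {φ : W →L[ℂ] Lp ℂ 2 μ} {ψ r : W}
    (hr : φ r =ᵐ[μ] fun x => ((φ ψ x).re : ℂ)) :
    φ ((-Complex.I) • (ψ - r)) ∈ realL2 (μ) := by
  rw [map_smul, map_sub]
  change ∀ᵐ x ∂μ, _
  filter_upwards [hr, Lp.coeFn_smul (-Complex.I) (φ ψ - φ r), Lp.coeFn_sub (φ ψ) (φ r)]
    with x h1 h2 h3
  rw [h2, Pi.smul_apply, h3, Pi.sub_apply, h1]
  simp

end RealPositive

section Matrices

variable {ι : Type*} [DecidableEq ι]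
    {X : ι → Type*} [∀ i, MeasurableSpace (X i)] {μ : ∀ i, Measure (X i)}
    {V : ι → Type*} [∀ i, NormedAddCommGroup (V i)] [∀ i, InnerProductSpace ℂ (V i)]
    {φ : ∀ i, V i →L[ℂ] Lp ℂ 2 (μ i)} {hφ : UniformlyBounded φ}
    {a : lp V 2 →ₗ[ℂ] lp V 2 →ₗ⋆[ℂ] ℂ}

theorem apply_single_mem {C : ∀ i, Set (Lp ℂ 2 (μ i))} (h0 : ∀ i, 0 ∈ C i) {j : ι} {ψ : V j}
    (hψ : φ j ψ ∈ C j) (k : ι) : φ k (lp.single (E := V) 2 j ψ k) ∈ C k := by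
  by_cases hk : k = j
  · subst hk; simpa using hψ
  · rw [lp.single_apply_ne _ _ _ hk, map_zero]; exact h0 k

/-- The invariance criterion for sets of `L²`-functions with values in a closed convex set `K` of
the plane. -/
theorem IsFormSemigroup.leavesInvariant_ae_iff [∀ i, CompleteSpace (V i)]
    {T : ℝ≥0 → (SumL2 μ →L[ℂ] SumL2 μ)}
    (hT : IsFormSemigroup (directSumMap φ hφ) a T)
    (hφinj : ∀ i, Function.Injective (φ i)) (hφd : ∀ i, DenseRange (φ i))
    (hcont : FormContinuous a) (hell : FormElliptic (directSumMap φ hφ) a)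
    (hacc : FormAccretive a) {π : ℂ → ℂ} {K : Set ℂ} (hπ : IsMetricProjection π K)
    (h0 : (0 : ℂ) ∈ K) :
    LeavesInvariant T {f | ∀ i, ∀ᵐ x ∂μ i, f i x ∈ K} ↔
      (∀ i (ψ : V i), ∃ u, φ i u =ᵐ[μ i] (fun x => π (φ i ψ x)) ∧
        0 ≤ (formEntry a i i u (ψ - u)).re) ∧
      ∀ ψ u : lp V 2, (∀ i, φ i (u i) =ᵐ[μ i] fun x => π (φ i (ψ i) x)) →
        0 ≤ (a u (ψ - u)).re := by
  have := hT.leavesInvariant_pi_iff hφinj hφd hcont hell hacc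
    (fun i => isMetricProjection_pointwiseProj (μ := μ i) hπ h0) (fun i => zero_mem_ae (μ i) h0)
  simp only [eq_pointwiseProj_iff] at this
  exact this

/-- The same criterion for the semigroup of a diagonal entry. -/
theorem IsFormSemigroup.leavesInvariant_ae_diag_iff [∀ i, CompleteSpace (V i)] {i : ι}
    {S : ℝ≥0 → (Lp ℂ 2 (μ i) →L[ℂ] Lp ℂ 2 (μ i))}
    (hS : IsFormSemigroup (φ i) (formEntry a i i) S)
    (hφinj : Function.Injective (φ i)) (hφd : DenseRange (φ i))
    (hcont : FormContinuous a) (hell : FormElliptic (directSumMap φ hφ) a)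
    (hacc : FormAccretive a) {π : ℂ → ℂ} {K : Set ℂ} (hπ : IsMetricProjection π K)
    (h0 : (0 : ℂ) ∈ K) :
    LeavesInvariant S {f | ∀ᵐ x ∂μ i, f x ∈ K} ↔
      ∀ ψ : V i, ∃ u, φ i u =ᵐ[μ i] (fun x => π (φ i ψ x)) ∧
        0 ≤ (formEntry a i i u (ψ - u)).re := by
  have := hS.leavesInvariant_iff hφinj hφd (hcont.diag i) (hell.diag i) (hacc.diag i)
    (isMetricProjection_pointwiseProj (μ := μ i) hπ h0)
  simp only [eq_pointwiseProj_iff] at this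
  exact this

/-! ### Reality -/

/-- A form that is real on real elements has vanishing real part at a real and an imaginary
element. -/
theorem re_formEntry_eq_zero_of_real
    (hreal : ∀ i j, ∀ ψ : V j, ∀ ψ' : V i, φ j ψ ∈ realL2 (μ j) → φ i ψ' ∈ realL2 (μ i) →
      (formEntry a i j ψ ψ').im = 0) {i j : ι} {u : V j} {w : V i}
    (hu : φ j u ∈ realL2 (μ j)) (hw : φ i ((-Complex.I) • w) ∈ realL2 (μ i)) :
    (formEntry a i j u w).re = 0 := by
  have := hreal i j u _ hu hw
  rw [LinearMap.map_smulₛₗ] at this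
  simpa using this

/-- Reality of the semigroup: the criterion for the projection `Re` requires `Im a(Re ψ, Im ψ) ≥ 0`,
which amounts to an equality since `Im ψ` may change its sign. -/
theorem IsFormSemigroup.leavesInvariant_real_iff [∀ i, CompleteSpace (V i)]
    {T : ℝ≥0 → (SumL2 μ →L[ℂ] SumL2 μ)}
    (hT : IsFormSemigroup (directSumMap φ hφ) a T)
    (hφinj : ∀ i, Function.Injective (φ i)) (hφd : ∀ i, DenseRange (φ i))
    (hcont : FormContinuous a) (hell : FormElliptic (directSumMap φ hφ) a)
    (hacc : FormAccretive a) :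
    LeavesInvariant T (realSumL2 μ) ↔
      (∀ i, ∀ ψ : V i, ∃ ψ' : V i, φ i ψ' =ᵐ[μ i] fun x => ((φ i ψ x).re : ℂ)) ∧
      (∀ i j, ∀ ψ : V j, ∀ ψ' : V i, φ j ψ ∈ realL2 (μ j) → φ i ψ' ∈ realL2 (μ i) →
        (formEntry a i j ψ ψ').im = 0) := by
  have hcrit := hT.leavesInvariant_ae_iff hφinj hφd hcont hell hacc isMetricProjection_re
    (by simp)
  refine Iff.trans hcrit ⟨?_, ?_⟩
  · rintro ⟨h1, h2⟩
    refine ⟨fun i ψ => (h1 i ψ).imp fun u hu => hu.1, fun i j ψ ψ' hψ hψ' => ?_⟩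
    -- the criterion for `ψ + i c ψ'`, whose real part is `ψ`, with `c = ± 1`
    have key : ∀ c : ℝ, 0 ≤ c * (formEntry a i j ψ ψ').im := by
      intro c
      have h3 := h2 (lp.single 2 j ψ + ((c : ℂ) * Complex.I) • lp.single 2 i ψ')
        (lp.single 2 j ψ) (fun k => by
          have hf : ∀ᵐ x ∂μ k, (φ k (lp.single (E := V) 2 j ψ k) x).im = 0 :=
            apply_single_mem (fun _ => zero_mem_realL2) hψ k
          have hg : ∀ᵐ x ∂μ k, (φ k (lp.single (E := V) 2 i ψ' k) x).im = 0 :=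
            apply_single_mem (fun _ => zero_mem_realL2) hψ' k
          rw [lp.coeFn_add, lp.coeFn_smul, Pi.add_apply, Pi.smul_apply, map_add, map_smul]
          filter_upwards [hf, hg, Lp.coeFn_add (φ k (lp.single (E := V) 2 j ψ k))
              (((c : ℂ) * Complex.I) • φ k (lp.single (E := V) 2 i ψ' k)),
            Lp.coeFn_smul ((c : ℂ) * Complex.I) (φ k (lp.single (E := V) 2 i ψ' k))]
            with x h4 h5 h6 h7
          rw [h6, Pi.add_apply, h7, Pi.smul_apply]
          apply Complex.ext <;> simp [-lp.single_apply, h4, h5])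
      rw [add_sub_cancel_left, LinearMap.map_smulₛₗ, ← formEntry_apply] at h3
      simpa using h3
    have k1 := key 1
    have k2 := key (-1)
    linarith
  · rintro ⟨h1, h2⟩
    have hz : ∀ i j (ψ u : V i) (v : V j), φ j v ∈ realL2 (μ j) →
        φ i u =ᵐ[μ i] (fun x => ((φ i ψ x).re : ℂ)) → 0 ≤ (formEntry a i j v (ψ - u)).re :=
      fun i j ψ u v hv hu =>
        (re_formEntry_eq_zero_of_real h2 hv (neg_I_smul_sub_mem_realL2 hu)).ge
    refine ⟨fun i ψ => ?_, fun ψ u hu => hcont.re_nonneg_of_entries fun i j => ?_⟩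
    · obtain ⟨u, hu⟩ := h1 i ψ
      exact ⟨u, hu, hz i i ψ u u (mem_realL2_of_ae_eq hu) hu⟩
    · exact hz i j (ψ i) (u i) (u j) (mem_realL2_of_ae_eq (hu j)) (hu i)

/-! ### Positivity -/

/-- Positivity of a real semigroup: in the criterion for the projection `ψ ↦ (Re ψ)⁺`, the diagonal
entries contribute the criterion for their own semigroups, and the entry `a_{ij}` with `i ≠ j`
contributes `-Re a_{ij}((Re ψ_j)⁺, (Re ψ_i)⁻)`. -/
theorem IsFormSemigroup.leavesInvariant_pos_iff [∀ i, CompleteSpace (V i)]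
    {T : ℝ≥0 → (SumL2 μ →L[ℂ] SumL2 μ)} {S : ∀ i, ℝ≥0 → (Lp ℂ 2 (μ i) →L[ℂ] Lp ℂ 2 (μ i))}
    (hT : IsFormSemigroup (directSumMap φ hφ) a T)
    (hS : ∀ i, IsFormSemigroup (φ i) (formEntry a i i) (S i))
    (hφinj : ∀ i, Function.Injective (φ i)) (hφd : ∀ i, DenseRange (φ i))
    (hcont : FormContinuous a) (hell : FormElliptic (directSumMap φ hφ) a)
    (hacc : FormAccretive a) (hreal : LeavesInvariant T (realSumL2 μ)) :
    LeavesInvariant T (posSumL2 μ) ↔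
      (∀ i, LeavesInvariant (S i) (posL2 (μ i))) ∧
      (∀ i j, i ≠ j → ∀ ψ : V j, ∀ ψ' : V i, φ j ψ ∈ posL2 (μ j) → φ i ψ' ∈ posL2 (μ i) →
        (formEntry a i j ψ ψ').im = 0 ∧ (formEntry a i j ψ ψ').re ≤ 0) := by
  have him := ((hT.leavesInvariant_real_iff hφinj hφd hcont hell hacc).1 hreal).2
  have hcrit := hT.leavesInvariant_ae_iff hφinj hφd hcont hell hacc isMetricProjection_max_re
    (by simp)
  have hcritS := fun i => (hS i).leavesInvariant_ae_diag_iff (hφinj i) (hφd i) hcont hell hacc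
    isMetricProjection_max_re (by simp)
  have hS' : (∀ i, LeavesInvariant (S i) (posL2 (μ i))) ↔ _ := forall_congr' hcritS
  refine Iff.trans hcrit (Iff.trans ?_ (and_congr_left' hS'.symm))
  refine and_congr_right fun h1 => ⟨?_, ?_⟩
  · intro h2 i j hij ψ ψ' hψ hψ'
    refine ⟨him i j ψ ψ' (posL2_subset_realL2 _ hψ) (posL2_subset_realL2 _ hψ'), ?_⟩
    -- the criterion for `ψ - ψ'`, whose positive part is `ψ` as the places differ
    have h3 := h2 (lp.single 2 j ψ - lp.single 2 i ψ') (lp.single 2 j ψ) (fun k => by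
      rw [lp.coeFn_sub, Pi.sub_apply, map_sub]
      have hf : ∀ᵐ x ∂μ k, (φ k (lp.single (E := V) 2 j ψ k) x).im = 0 ∧
          0 ≤ (φ k (lp.single (E := V) 2 j ψ k) x).re :=
        apply_single_mem (fun _ => zero_mem_posL2) hψ k
      have hg : ∀ᵐ x ∂μ k, (φ k (lp.single (E := V) 2 i ψ' k) x).im = 0 ∧
          0 ≤ (φ k (lp.single (E := V) 2 i ψ' k) x).re :=
        apply_single_mem (fun _ => zero_mem_posL2) hψ' k
      have hfg : ∀ᵐ x ∂μ k, φ k (lp.single (E := V) 2 j ψ k) x = 0 ∨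
          φ k (lp.single (E := V) 2 i ψ' k) x = 0 := by
        by_cases hk : k = i
        · have hkj : k ≠ j := hk ▸ hij
          rw [lp.single_apply_ne 2 j ψ hkj, map_zero]
          filter_upwards [Lp.coeFn_zero ℂ 2 (μ k)] with x hx
          exact Or.inl hx
        · rw [lp.single_apply_ne 2 i ψ' hk, map_zero]
          filter_upwards [Lp.coeFn_zero ℂ 2 (μ k)] with x hx
          exact Or.inr hx
      filter_upwards [hf, hg, hfg, Lp.coeFn_sub (φ k (lp.single (E := V) 2 j ψ k))
        (φ k (lp.single (E := V) 2 i ψ' k))] with x h4 h5 h6 h7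
      rw [h7, Pi.sub_apply]
      rcases h6 with h6 | h6
      · rw [h6, zero_sub, Complex.neg_re, max_eq_right (by linarith [h5.2]), Complex.ofReal_zero]
      · rw [h6, sub_zero, max_eq_left h4.2]
        apply Complex.ext <;> simp [-lp.single_apply, h4.1])
    rw [sub_sub_cancel_left, map_neg, ← formEntry_apply, Complex.neg_re] at h3
    linarith
  · intro h2 ψ u hu
    refine hcont.re_nonneg_of_entries fun i j => ?_
    rw [lp.coeFn_sub, Pi.sub_apply]
    by_cases hij : i = j
    · subst hij
      obtain ⟨u', hu', h3⟩ := h1 i (ψ i)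
      have : u' = u i := hφinj i (Lp.ext (hu'.trans (hu i).symm))
      rwa [this] at h3
    · -- `n` is the negative part of the real part of `ψ i`
      obtain ⟨n, hn, -⟩ := h1 i (-ψ i)
      have hr : φ i (u i - n) =ᵐ[μ i] fun x => ((φ i (ψ i) x).re : ℂ) := by
        rw [map_sub]
        rw [map_neg] at hn
        filter_upwards [hu i, hn, Lp.coeFn_sub (φ i (u i)) (φ i n), Lp.coeFn_neg (φ i (ψ i))]
          with x h3 h4 h5 h6
        rw [h5, Pi.sub_apply, h3, h4, h6, Pi.neg_apply, Complex.neg_re, ← Complex.ofReal_sub]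
        congr 1
        rcases le_total 0 (φ i (ψ i) x).re with h | h
        · rw [max_eq_left h, max_eq_right (by linarith), sub_zero]
        · rw [max_eq_right h, max_eq_left (by linarith)]; ring
      have huj : φ j (u j) ∈ posL2 (μ j) := mem_posL2_of_ae_eq (hu j)
      have e : ψ i - u i = (ψ i - (u i - n)) - n := by abel
      rw [e, map_sub, Complex.sub_re, re_formEntry_eq_zero_of_real him
        (posL2_subset_realL2 _ huj) (neg_I_smul_sub_mem_realL2 hr)]
      have := (h2 i j hij (u j) n huj (mem_posL2_of_ae_eq hn)).2
      linarith

end Matrices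

/-! ### Contractivity in `L^∞` -/

section Contractivity

variable {ι : Type*} {X : ι → Type*} [∀ i, MeasurableSpace (X i)] {μ : ∀ i, Measure (X i)}

theorem eLpNorm_top_le_ofReal_iff {Y : Type*} [MeasurableSpace Y] {ν : Measure Y} {f : Y → ℂ}
    {r : ℝ} (hr : 0 ≤ r) : eLpNorm f ∞ ν ≤ ENNReal.ofReal r ↔ ∀ᵐ x ∂ν, ‖f x‖ ≤ r := by
  rw [eLpNorm_exponent_top]
  refine ⟨fun h => ?_, eLpNormEssSup_le_of_ae_bound⟩
  filter_upwards [ae_le_eLpNormEssSup (f := f) (μ := ν)] with x hx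
  have := hx.trans h
  rwa [← ofReal_norm, ENNReal.ofReal_le_ofReal_iff hr] at this

theorem eLpNorm_top_le_one_iff {Y : Type*} [MeasurableSpace Y] {ν : Measure Y} {f : Y → ℂ} :
    eLpNorm f ∞ ν ≤ 1 ↔ ∀ᵐ x ∂ν, ‖f x‖ ≤ 1 := by
  rw [← eLpNorm_top_le_ofReal_iff zero_le_one, ENNReal.ofReal_one]

theorem linftyNorm_le_ofReal_iff {f : SumL2 μ} {r : ℝ} (hr : 0 ≤ r) :
    linftyNorm f ≤ ENNReal.ofReal r ↔ ∀ i, ∀ᵐ x ∂μ i, ‖f i x‖ ≤ r := by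
  simp only [linftyNorm, iSup_le_iff, eLpNorm_top_le_ofReal_iff hr]

theorem ae_norm_smul_le {f : SumL2 μ} {r s : ℝ} (hs : 0 ≤ s)
    (hf : ∀ i, ∀ᵐ x ∂μ i, ‖f i x‖ ≤ r) (i : ι) : ∀ᵐ x ∂μ i, ‖((s : ℂ) • f) i x‖ ≤ s * r := by
  rw [lp.coeFn_smul, Pi.smul_apply]
  filter_upwards [hf i, Lp.coeFn_smul (s : ℂ) (f i)] with x h1 h2
  rw [h2, Pi.smul_apply, norm_smul, Complex.norm_real, Real.norm_of_nonneg hs]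
  gcongr

/-- By homogeneity, `L^∞`-contractivity is the invariance of the unit ball of `L^∞`. -/
theorem isLinftyContractive_iff_leavesInvariant {T : ℝ≥0 → (SumL2 μ →L[ℂ] SumL2 μ)} :
    IsLinftyContractive T ↔ LeavesInvariant T {f | ∀ i, ∀ᵐ x ∂μ i, f i x ∈ {z : ℂ | ‖z‖ ≤ 1}} := by
  constructor
  · intro h t f hf
    have hf' := (linftyNorm_le_ofReal_iff zero_le_one).2 hf
    exact (linftyNorm_le_ofReal_iff zero_le_one).1 ((h t f).trans hf')
  · intro h t f
    refine le_of_forall_gt_imp_ge_of_dense fun b hb => ?_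
    rcases eq_or_ne b ∞ with rfl | hb'
    · exact le_top
    · have hr : 0 < b.toReal := ENNReal.toReal_pos (bot_lt_of_lt hb).ne' hb'
      rw [← ENNReal.ofReal_toReal hb'] at hb ⊢
      rw [linftyNorm_le_ofReal_iff hr.le]
      have h1 := ae_norm_smul_le (inv_nonneg.2 hr.le) ((linftyNorm_le_ofReal_iff hr.le).1 hb.le)
      rw [inv_mul_cancel₀ hr.ne'] at h1
      have h2 := ae_norm_smul_le hr.le (h t _ h1)
      rwa [map_smul, smul_smul, ← Complex.ofReal_mul, mul_inv_cancel₀ hr.ne', Complex.ofReal_one,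
        one_smul, mul_one] at h2

variable {V : ι → Type*} [∀ i, NormedAddCommGroup (V i)] [∀ i, InnerProductSpace ℂ (V i)]
    {φ : ∀ i, V i →L[ℂ] Lp ℂ 2 (μ i)} {hφ : UniformlyBounded φ}

theorem coeFn_sub_unitTrunc {i : ι} {ψ u : V i}
    (hu : φ i u =ᵐ[μ i] fun x => unitTrunc (φ i ψ x)) :
    φ i (ψ - u) =ᵐ[μ i] fun x => unitExcess (φ i ψ x) := by
  rw [map_sub]
  filter_upwards [hu, Lp.coeFn_sub (φ i ψ) (φ i u)] with x h1 h2
  rw [h2, Pi.sub_apply, h1]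
  nth_rewrite 1 [← unitTrunc_add_unitExcess (φ i ψ x)]
  ring

theorem unitTrunc_eq_self {z : ℂ} (hz : ‖z‖ ≤ 1) : unitTrunc z = z :=
  isMetricProjection_unitTrunc.apply_eq_self hz

theorem norm_unitTrunc_le (z : ℂ) : ‖unitTrunc z‖ ≤ 1 := isMetricProjection_unitTrunc.mem z

theorem exists_lp_smul (ψ : lp V 2) {d : ι → ℂ} (hd : ∀ j, ‖d j‖ ≤ 1) :
    ∃ S : lp V 2, ∀ j, S j = d j • ψ j := by
  have : Memℓp (fun j => d j • ψ j) 2 := (lp.memℓp ψ).mono' fun j => by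
    rw [norm_smul]
    exact mul_le_of_le_one_left (norm_nonneg _) (hd j)
  exact ⟨⟨_, this⟩, fun _ => rfl⟩

variable [DecidableEq ι] {a : lp V 2 →ₗ[ℂ] lp V 2 →ₗ⋆[ℂ] ℂ}

/-- The contractivity estimate follows from the invariance criterion, applied to a vector whose
components at the places `j ≠ i` are rotated so that all `a_{ij}(ψ_j, w)` become negative. -/
theorem summable_and_tsum_le_of_criterion (hcont : FormContinuous a)
    (hcrit : ∀ ψ u : lp V 2, (∀ i, φ i (u i) =ᵐ[μ i] fun x => unitTrunc (φ i (ψ i) x)) →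
        0 ≤ (a u (ψ - u)).re) (i : ι) (ψ : lp V 2)
    (hψ : ∀ j, j ≠ i → ∀ᵐ x ∂μ j, ‖φ j (ψ j) x‖ ≤ 1) {u : V i}
    (hu : φ i u =ᵐ[μ i] fun x => unitTrunc (φ i (ψ i) x)) :
    Summable (fun j : {j : ι // j ≠ i} => ‖formEntry a i j (ψ j) (ψ i - u)‖) ∧
      ∑' j : {j : ι // j ≠ i}, ‖formEntry a i j (ψ j) (ψ i - u)‖
        ≤ (formEntry a i i u (ψ i - u)).re := by
  set w := ψ i - u with hw
  let d : ι → ℂ := fun j =>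
    if j = i then 0 else -(starRingEnd ℂ) (csign (formEntry a i j (ψ j) w))
  have hd : ∀ j, ‖d j‖ ≤ 1 := by
    intro j
    by_cases hj : j = i
    · simp [d, hj]
    · simpa [d, hj] using norm_csign_le _
  obtain ⟨S, hS⟩ := exists_lp_smul ψ hd
  have hsum : HasSum (fun j => if j = i then 0 else ‖formEntry a i j (ψ j) w‖)
      (-(a S (lp.single 2 i w)).re) := by
    refine (Complex.hasSum_re (hcont.hasSum_formEntry S i w)).neg.congr_fun fun j => ?_
    rw [hS]
    by_cases hj : j = i
    · simp [d, hj]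
    · simp only [d, hj, if_false, map_smul, LinearMap.smul_apply, smul_eq_mul, neg_mul,
        conj_csign_mul, Complex.neg_re, Complex.ofReal_re, neg_neg]
  have hsub : HasSum (fun j : {j : ι // j ≠ i} => ‖formEntry a i j (ψ j) w‖)
      (-(a S (lp.single 2 i w)).re) := by
    refine ((hasSum_subtype_iff_of_support_subset (s := {j | j ≠ i}) ?_).2 hsum).congr_fun ?_
    · intro j hj hji
      exact hj (if_pos hji)
    · intro j
      exact (if_neg j.2).symm
  have h := hcrit (lp.single 2 i (ψ i) + S) (lp.single 2 i u + S) (fun k => by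
    rw [lp.coeFn_add, lp.coeFn_add, Pi.add_apply, Pi.add_apply, hS]
    by_cases hk : k = i
    · subst hk
      simpa [d] using hu
    · rw [lp.single_apply_ne _ _ _ hk, lp.single_apply_ne _ _ _ hk, zero_add, map_smul]
      filter_upwards [hψ k hk, Lp.coeFn_smul (d k) (φ k (ψ k))] with x h1 h2
      refine (unitTrunc_eq_self ?_).symm
      rw [h2, Pi.smul_apply, norm_smul]
      exact mul_le_one₀ (hd k) (norm_nonneg _) h1)
  rw [add_sub_add_right_eq_sub, ← lp.single_sub, ← hw, map_add, LinearMap.add_apply,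
    Complex.add_re, ← formEntry_apply] at h
  refine ⟨hsub.summable, ?_⟩
  rw [hsub.tsum_eq]
  linarith

/-- `L^∞`-contractivity: the criterion for the projection `ψ_i ↦ (1 ∧ |ψ_i|) sign ψ_i`.
Contractivity of the semigroup in `H` is automatic, as the form is accretive. -/
theorem IsFormSemigroup.isLinftyContractive_iff [∀ i, CompleteSpace (V i)]
    {T : ℝ≥0 → (SumL2 μ →L[ℂ] SumL2 μ)}
    (hT : IsFormSemigroup (directSumMap φ hφ) a T)
    (hφinj : ∀ i, Function.Injective (φ i)) (hφd : ∀ i, DenseRange (φ i))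
    (hcont : FormContinuous a) (hell : FormElliptic (directSumMap φ hφ) a)
    (hacc : FormAccretive a) :
    IsLinftyContractive T ↔
      (∀ i, ∀ ψ : V i, ∃ ψ' : V i, φ i ψ' =ᵐ[μ i] fun x => unitTrunc (φ i ψ x)) ∧
      (∀ i, ∀ ψ : lp V 2, (∀ j, j ≠ i → eLpNorm (φ j (ψ j)) ∞ (μ j) ≤ 1) →
        ∀ u w : V i, (φ i u =ᵐ[μ i] fun x => unitTrunc (φ i (ψ i) x)) →
          (φ i w =ᵐ[μ i] fun x => unitExcess (φ i (ψ i) x)) →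
          Summable (fun j : {j : ι // j ≠ i} => ‖formEntry a i j (ψ j) w‖) ∧
          ∑' j : {j : ι // j ≠ i}, ‖formEntry a i j (ψ j) w‖
            ≤ (formEntry a i i u w).re) := by
  rw [isLinftyContractive_iff_leavesInvariant, hT.leavesInvariant_ae_iff hφinj hφd hcont hell hacc
    isMetricProjection_unitTrunc (by simp)]
  constructor
  · rintro ⟨h1, h2⟩
    refine ⟨fun i ψ => (h1 i ψ).imp fun u hu => hu.1, fun i ψ hψ u w hu hw => ?_⟩
    obtain rfl : w = ψ i - u := hφinj i (Lp.ext (hw.trans (coeFn_sub_unitTrunc hu).symm))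
    exact summable_and_tsum_le_of_criterion hcont h2 i ψ
      (fun j hj => eLpNorm_top_le_one_iff.1 (hψ j hj)) hu
  · rintro ⟨h1, h2⟩
    refine ⟨fun i ψ => ?_, fun ψ u hu => ?_⟩
    · obtain ⟨u, hu⟩ := h1 i ψ
      refine ⟨u, hu, ?_⟩
      have e : lp.single (E := V) 2 i ψ i = ψ := lp.single_apply_self _ _ _
      have := (h2 i (lp.single 2 i ψ) (fun j hj => ?_) u (ψ - u) (by rwa [e])
        (by rw [e]; exact coeFn_sub_unitTrunc hu)).2
      · exact (tsum_nonneg fun _ => norm_nonneg _).trans this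
      · rw [lp.single_apply_ne _ _ _ hj, map_zero, eLpNorm_congr_ae (Lp.coeFn_zero ℂ 2 (μ j)),
          eLpNorm_zero]
        exact zero_le_one
    · refine (Complex.hasSum_re (hcont.hasSum_right u (ψ - u))).nonneg fun i => ?_
      set w := (ψ - u) i with hw
      -- the vector with `ψ i` at the place `i` and the truncated `u j` elsewhere
      let χ : lp V 2 := u + lp.single 2 i w
      have hχi : χ i = ψ i := by
        change u i + lp.single (E := V) 2 i w i = ψ i
        rw [lp.single_apply_self]
        exact add_sub_cancel (u i) (ψ i)
      have hχj : ∀ j, j ≠ i → χ j = u j := by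
        intro j hj
        change u j + lp.single (E := V) 2 i w j = u j
        rw [lp.single_apply_ne _ _ _ hj, add_zero]
      obtain ⟨h3, h4⟩ := h2 i χ (fun j hj => by
          rw [hχj j hj, eLpNorm_top_le_one_iff]
          filter_upwards [hu j] with x hx
          rw [hx]
          exact norm_unitTrunc_le _) (u i) w (by rw [hχi]; exact hu i)
        (by rw [hχi]; exact coeFn_sub_unitTrunc (hu i))
      have e : (fun j : {j : ι // j ≠ i} => ‖formEntry a i j (χ j) w‖) =
          (fun j => if j = i then 0 else ‖formEntry a i j (u j) w‖) ∘ Subtype.val := by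
        funext j
        simp [hχj j j.2, j.2]
      rw [e] at h3 h4
      have h5 : HasSum (fun j => if j = i then 0 else ‖formEntry a i j (u j) w‖) _ :=
        (hasSum_subtype_iff_of_support_subset (s := {j | j ≠ i})
          (fun j hj hji => hj (if_pos hji))).1 h3.hasSum
      have h6 := (hasSum_ite_eq i (formEntry a i i (u i) w).re).sub h5
      have h7 := hasSum_le (fun j => ?_) h6
        (Complex.hasSum_re (hcont.hasSum_formEntry u i w))
      · exact (sub_nonneg.2 h4).trans h7
      · by_cases hj : j = i
        · subst hj; simp
        · simp only [hj, if_false, zero_sub]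
          exact neg_le_of_abs_le (Complex.abs_re_le_norm _)

end Contractivity

end

theorem theorem1p6
    {ι : Type*} [Countable ι] [DecidableEq ι]
    {X : ι → Type*} [∀ i, MeasurableSpace (X i)]
    (μ : ∀ i, Measure (X i)) [∀ i, SigmaFinite (μ i)]
    {V : ι → Type*} [∀ i, NormedAddCommGroup (V i)] [∀ i, InnerProductSpace ℂ (V i)]
    [∀ i, CompleteSpace (V i)]
    -- the embeddings of `V_i` in `H_i = L²(X_i)`
    (φ : ∀ i, V i →L[ℂ] Lp ℂ 2 (μ i))
    (hφinj : ∀ i, Function.Injective (φ i)) (hφdense : ∀ i, DenseRange (φ i))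
    (hφ : UniformlyBounded φ)
    -- the form on `⊕ V_i`
    (a : lp V 2 →ₗ[ℂ] lp V 2 →ₗ⋆[ℂ] ℂ)
    (hcont : FormContinuous a) (hell : FormElliptic (directSumMap φ hφ) a)
    (hacc : FormAccretive a) :
    -- the semigroups of `a` and of the diagonal entries `a_{ii}` are well defined
    (∃! T : ℝ≥0 → (SumL2 μ →L[ℂ] SumL2 μ), IsFormSemigroup (directSumMap φ hφ) a T) ∧
    (∀ i, ∃! S : ℝ≥0 → (Lp ℂ 2 (μ i) →L[ℂ] Lp ℂ 2 (μ i)),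
      IsFormSemigroup (φ i) (formEntry a i i) S) ∧
    ∀ (T : ℝ≥0 → (SumL2 μ →L[ℂ] SumL2 μ))
      (S : ∀ i, ℝ≥0 → (Lp ℂ 2 (μ i) →L[ℂ] Lp ℂ 2 (μ i))),
      IsFormSemigroup (directSumMap φ hφ) a T →
      (∀ i, IsFormSemigroup (φ i) (formEntry a i i) (S i)) →
      -- reality
      (LeavesInvariant T (realSumL2 μ) ↔
        (∀ i, ∀ ψ : V i, ∃ ψ' : V i, φ i ψ' =ᵐ[μ i] fun x => ((φ i ψ x).re : ℂ)) ∧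
        (∀ i j, ∀ ψ : V j, ∀ ψ' : V i, φ j ψ ∈ realL2 (μ j) → φ i ψ' ∈ realL2 (μ i) →
          (formEntry a i j ψ ψ').im = 0)) ∧
      -- positivity
      (LeavesInvariant T (realSumL2 μ) →
        (LeavesInvariant T (posSumL2 μ) ↔
          (∀ i, LeavesInvariant (S i) (posL2 (μ i))) ∧
          (∀ i j, i ≠ j → ∀ ψ : V j, ∀ ψ' : V i, φ j ψ ∈ posL2 (μ j) → φ i ψ' ∈ posL2 (μ i) →
            (formEntry a i j ψ ψ').im = 0 ∧ (formEntry a i j ψ ψ').re ≤ 0))) ∧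
      -- contractivity with respect to the `L^∞` norm
      (IsContractiveFamily T →
        (IsLinftyContractive T ↔
          (∀ i, ∀ ψ : V i, ∃ ψ' : V i, φ i ψ' =ᵐ[μ i] fun x => unitTrunc (φ i ψ x)) ∧
          (∀ i, ∀ ψ : lp V 2, (∀ j, j ≠ i → eLpNorm (φ j (ψ j)) ∞ (μ j) ≤ 1) →
            ∀ u w : V i, (φ i u =ᵐ[μ i] fun x => unitTrunc (φ i (ψ i) x)) →
              (φ i w =ᵐ[μ i] fun x => unitExcess (φ i (ψ i) x)) →
              Summable (fun j : {j : ι // j ≠ i} => ‖formEntry a i j (ψ j) w‖) ∧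
              ∑' j : {j : ι // j ≠ i}, ‖formEntry a i j (ψ j) w‖
                ≤ (formEntry a i i u w).re))) := by
  have hJ := directSumMap_injective (hφ := hφ) hφinj
  have hJd := directSumMap_denseRange (hφ := hφ) hφdense
  refine ⟨existsUnique_isFormSemigroup hJ hJd hcont hell hacc, fun i =>
    existsUnique_isFormSemigroup (hφinj i) (hφdense i) (hcont.diag i) (hell.diag i) (hacc.diag i),
    fun T S hT hS => ⟨hT.leavesInvariant_real_iff hφinj hφdense hcont hell hacc,
      fun hreal => hT.leavesInvariant_pos_iff hS hφinj hφdense hcont hell hacc hreal,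
      fun _ => hT.isLinftyContractive_iff hφinj hφdense hcont hell hacc⟩⟩
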